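/- Let $d\ge 1$ and $\lambda\in\mathbb R\setminus\{0\}$. Write $z_j=x_j+iy_j$ for the coordinates on $\mathbb C^d$, and let $$L_\lambda=-\Delta_{\mathbb C^d}+\tfrac14\lambda^2\|z\|^2-i\lambda\sum_{j=1}^d\Big(x_j\frac{\partial}{\partial y_j}-y_j\frac{\partial}{\partial x_j}\Big)$$ be the special Hermite operator, where $\Delta_{\mathbb C^d}=\sum_j(\partial_{x_j}^2+\partial_{y_j}^2)$. Let $E,\Omega\subset\mathbb C^d$ be measurable sets of finite Lebesgue measure, let $u_0\in L^2(\mathbb C^d)$, and let $u$ be a solution of $$i\,\partial_t u=L_\lambda u\quad\text{on }\mathbb C^d\times(0,\infty),\qquad u(\cdot,0)=u_0,$$ that is, $u\in C([0,\infty);L^2(\mathbb C^d))$, $u(\cdot,0)=u_0$, and for every $\varphi\in C_c^\infty(\mathbb C^d)$ and every $t>0$ $$i\,\frac{d}{dt}\int_{\mathbb C^d}u(z,t)\,\overline{\varphi(z)}\,dz=\int_{\mathbb C^d}u(z,t)\,\overline{L_\lambda\varphi(z)}\,dz .$$ If there exists $t>0$ with $\lambda t\notin\pi\mathbb Z$ such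 that $u_0=0$ almost everywhere outside $E$ and $u(\cdot,t)=0$ almost everywhere outside $\Omega$, then $u$ vanishes identically, i.e. $u(\cdot,s)=0$ in $L^2(\mathbb C^d)$ for every $s\ge 0$. -/

import Mathlib

open MeasureTheory
open scoped ContDiff ComplexConjugate InnerProductSpace Laplacian

/-- The space `ℂ^d` with its Euclidean norm, regarded as a real inner product space of
dimension `2d`; `volume` on it is Lebesgue measure. -/
abbrev CSpace (d : ℕ) : Type := EuclideanSpace ℂ (Fin d)

/-- The complex Hilbert space `L²(ℂ^d)`. -/
abbrev L2CSpace (d : ℕ) : Type := Lp ℂ 2 (volume : Measure (CSpace d))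

/-- The partial derivative `∂f/∂x_j` at `z`, where `z_j = x_j + i y_j`. -/
noncomputable def partialX {d : ℕ} (j : Fin d) (f : CSpace d → ℂ) (z : CSpace d) : ℂ :=
  fderiv ℝ f z (EuclideanSpace.single j 1)

/-- The partial derivative `∂f/∂y_j` at `z`, where `z_j = x_j + i y_j`. -/
noncomputable def partialY {d : ℕ} (j : Fin d) (f : CSpace d → ℂ) (z : CSpace d) : ℂ :=
  fderiv ℝ f z (EuclideanSpace.single j Complex.I)

/-- The special Hermite operator
`L_λ = -Δ + (1/4) λ² ‖z‖² - i λ ∑_j (x_j ∂/∂y_j - y_j ∂/∂x_j)`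
acting on (twice differentiable) functions on `ℂ^d`. -/
noncomputable def specialHermite {d : ℕ} (lam : ℝ) (f : CSpace d → ℂ) (z : CSpace d) : ℂ :=
  -(Δ f) z + ((1 / 4 * lam ^ 2 * ‖z‖ ^ 2 : ℝ) : ℂ) * f z
    - Complex.I * (lam : ℂ) *
      ∑ j : Fin d, (((z j).re : ℂ) * partialY j f z - ((z j).im : ℂ) * partialX j f z)

/-- `u` is a solution of the special Hermite Schrödinger equation
`i ∂_t u = L_λ u` on `ℂ^d × (0, ∞)`, `u(·, 0) = u₀ ∈ L²(ℂ^d)`: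
`u` is a continuous curve `[0, ∞) → L²(ℂ^d)` starting at `u₀` that satisfies the equation
weakly. Since `L_λ` is formally self-adjoint, testing against `φ ∈ C_c^∞(ℂ^d)` reads
`i d/dt ⟨u(t), φ⟩ = ⟨u(t), L_λ φ⟩` for all `t > 0`, where `⟨f, g⟩ = ∫ f conj(g)`.
Only the values of `u` at times `t ≥ 0` matter. -/
structure IsSpecialHermiteSchrodingerSolution {d : ℕ} (lam : ℝ) (u₀ : L2CSpace d)
    (u : ℝ → L2CSpace d) : Prop where
  continuousOn : ContinuousOn u (Set.Ici 0)
  initial : u 0 = u₀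
  equation : ∀ φ : CSpace d → ℂ, ContDiff ℝ ∞ φ → HasCompactSupport φ → ∀ t : ℝ, 0 < t →
    HasDerivAt (fun s : ℝ => ∫ z, u s z * conj (φ z))
      (-Complex.I * ∫ z, u t z * conj (specialHermite lam φ z)) t

/-!
# Uniqueness for the special Hermite Schrödinger equation from supports at two times

Off the resonant times `λt ∈ πℤ` the propagator of `L_λ` has the kernel (`schrodingerKernel`)
`C exp(iκ‖z‖² + iκ‖w‖² + i⟪m w, z⟫)`, with `κ = (λ/4) cot(λt)` real and `m` a nonzero complex number.
So, up to multiplication by the unimodular chirp `exp(iκ‖·‖²)`, a nonzero constant and the complex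
dilation by `-m̄/2π`, the map `u(0) ↦ u(t)` is the Fourier transform
(`integral_schrodingerKernel_mul`). If `u(0)` and `u(t)` live on sets of finite measure, then so do
`f = exp(iκ‖·‖²) u(0)` and `𝓕 f`, and Benedicks' theorem
(`ae_eq_zero_of_fourier_ae_eq_zero_off`) gives `f = 0`. Uniqueness of weak solutions
(`eq_zero_of_initial_eq_zero`) then propagates `u(0) = 0` to all times.

Benedicks' theorem is proved by a dimension count. A finite-dimensional space of functions `g` which
live on `E` and whose transforms live on `Ω` has dimension at most `(|E| |Ω|)²`, because there
`‖𝓕 g‖_∞ ≤ |E| |Ω|^{1/2} ‖𝓕 g‖₂`. But `n` translates of `f` by small multiples of one vector are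
linearly independent and still live on a set of measure at most `|E| + 1`, for every `n`.

That a weak solution is given by the kernel is shown by duality with Gaussians. The state
`exp(-(|λ|/4)‖z‖² + i⟪ξ, z⟫)`, evolved backwards by the flow, remains an explicit Gaussian
(`backwardState`), without singularities in time, and the pairing of a weak solution with it is
constant (`integral_mul_conj_eq_of_classical_solution`). Integrating the kernel against such a state
is a Gaussian integral with the same value, and the pairings with all these states are the Fourier
transform of `u(t) exp(-(|λ|/4)‖·‖²)`, which determines `u(t)`.
-/

open MeasureTheory
open scoped ContDiff ComplexConjugate InnerProductSpace Laplacian FourierTransform ENNReal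

/-! ### Fourier inversion for integrable functions -/

section FourierInversion

variable {V : Type*} [NormedAddCommGroup V] [InnerProductSpace ℝ V] [FiniteDimensional ℝ V]
  [MeasurableSpace V] [BorelSpace V]

theorem integral_fourier_mul_eq {f g : V → ℂ} (hf : Integrable f) (hg : Integrable g) :
    ∫ ξ, 𝓕 f ξ * g ξ = ∫ x, f x * 𝓕 g x := by
  simpa using! VectorFourier.integral_bilin_fourierIntegral_eq_flip (.mul ℂ ℂ) (L := innerₗ V)
    Real.continuous_fourierChar continuous_inner hf hg

theorem integral_fourierInv_mul_eq {f g : V → ℂ} (hf : Integrable f) (hg : Integrable g) :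
    ∫ ξ, 𝓕⁻ f ξ * g ξ = ∫ x, f x * 𝓕⁻ g x := by
  rw [Real.fourierInv_eq_fourier_comp_neg, integral_fourier_mul_eq hf.comp_neg hg,
    ← integral_neg_eq_self]
  simp [Real.fourierInv_eq_fourier_neg]

theorem continuous_fourier {f : V → ℂ} (hf : Integrable f) : Continuous (𝓕 f) :=
  VectorFourier.fourierIntegral_continuous Real.continuous_fourierChar
    (by exact continuous_inner) hf

theorem norm_fourier_le {f : V → ℂ} (ξ : V) : ‖𝓕 f ξ‖ ≤ ∫ x, ‖f x‖ :=
  VectorFourier.norm_fourierIntegral_le_integral_norm _ _ _ _ _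

theorem norm_fourierInv_le {f : V → ℂ} (ξ : V) : ‖𝓕⁻ f ξ‖ ≤ ∫ x, ‖f x‖ :=
  VectorFourier.norm_fourierIntegral_le_integral_norm _ _ _ _ _

theorem continuous_fourierInv {f : V → ℂ} (hf : Integrable f) : Continuous (𝓕⁻ f) := by
  rw [Real.fourierInv_eq_fourier_comp_neg]
  exact continuous_fourier hf.comp_neg

/-- Fourier inversion almost everywhere: unlike Mathlib's pointwise version, no continuity of `f`
is needed. -/
theorem ae_eq_fourierInv_fourier {f : V → ℂ} (hf : Integrable f) (hf' : Integrable (𝓕 f)) :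
    f =ᵐ[volume] 𝓕⁻ (𝓕 f) := by
  have hloc : LocallyIntegrable (𝓕⁻ (𝓕 f)) (volume : Measure V) :=
    (continuous_fourierInv hf').locallyIntegrable
  refine ae_eq_of_integral_contDiff_smul_eq hf.locallyIntegrable hloc fun φ hφ hφc => ?_
  have h1 : HasCompactSupport (fun x => (φ x : ℂ)) := hφc.comp_left (g := fun x : ℝ => (x : ℂ)) rfl
  let Φ : SchwartzMap V ℂ := h1.toSchwartzMap (Complex.ofRealCLM.contDiff.comp hφ)
  have hΦ : ∀ x, (φ x : ℂ) = Φ x := fun x => rfl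
  have h2 : 𝓕 (𝓕⁻ (Φ : V → ℂ)) = (Φ : V → ℂ) := by
    rw [← SchwartzMap.fourierInv_coe, ← SchwartzMap.fourier_coe,
      FourierTransform.fourier_fourierInv_eq]
  have h3 : Integrable (𝓕⁻ (Φ : V → ℂ)) := by
    rw [← SchwartzMap.fourierInv_coe]; exact SchwartzMap.integrable _
  calc ∫ x, φ x • f x = ∫ x, f x * 𝓕 (𝓕⁻ (Φ : V → ℂ)) x := by
        rw [h2]; congr 1; ext x; rw [← hΦ, Complex.real_smul, mul_comm]
    _ = ∫ x, 𝓕 f x * 𝓕⁻ (Φ : V → ℂ) x := (integral_fourier_mul_eq hf h3).symm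
    _ = ∫ x, 𝓕⁻ (𝓕 f) x * Φ x := (integral_fourierInv_mul_eq hf' (SchwartzMap.integrable Φ)).symm
    _ = _ := by congr 1; ext x; rw [← hΦ, Complex.real_smul, mul_comm]

theorem ae_eq_zero_of_fourier_ae_eq_zero {f : V → ℂ} (hf : Integrable f)
    (h : 𝓕 f =ᵐ[volume] 0) : f =ᵐ[volume] 0 := by
  have h0 : Integrable (𝓕 f) := (integrable_congr h).2 (integrable_zero _ _ _)
  filter_upwards [ae_eq_fourierInv_fourier hf h0] with x hx
  rw [hx, Real.fourierInv_eq_fourier_neg, Real.fourier_congr_ae h]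
  simp [Real.fourier_eq]

end FourierInversion

/-! ### Benedicks' theorem -/

section Benedicks

theorem eLpNorm_eq_restrict_of_ae_eq_zero_off {α : Type*} [MeasurableSpace α] {μ : Measure α}
    {f : α → ℂ} {s : Set α} (hs : MeasurableSet s) (h : ∀ᵐ x ∂μ, x ∉ s → f x = 0) (p : ℝ≥0∞) :
    eLpNorm f p μ = eLpNorm f p (μ.restrict s) := by
  rw [← eLpNorm_indicator_eq_eLpNorm_restrict hs]
  refine eLpNorm_congr_ae ?_
  filter_upwards [h] with x hx
  by_cases hxs : x ∈ s
  · simp [hxs]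
  · simp [hxs, hx hxs]

/-- A finite-dimensional space of `L²` functions living on a set of finite measure, on which the sup
norm is controlled by the `L²` norm, has dimension bounded by the constants involved: for an
orthonormal basis `bᵢ`, the control gives `∑ |bᵢ(x)|² ≤ M²` pointwise. -/
theorem finrank_le_of_norm_ae_le {α : Type*} [MeasurableSpace α] {μ : Measure α}
    (S : Submodule ℂ (Lp ℂ 2 μ)) [FiniteDimensional ℂ S] {Ω : Set α} (hΩ : MeasurableSet Ω)
    (hΩ' : μ Ω ≠ ⊤) {M : ℝ} (hS : ∀ g ∈ S, ∀ᵐ x ∂μ, x ∉ Ω → g x = 0)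
    (hM : ∀ g ∈ S, ∀ᵐ x ∂μ, ‖g x‖ ≤ M * ‖g‖) :
    (Module.finrank ℂ S : ℝ) ≤ M ^ 2 * μ.real Ω := by
  let b := stdOrthonormalBasis ℂ S
  set n := Module.finrank ℂ S
  -- The null set in `hM` depends on `g`, so a countable dense set of coefficient vectors is used.
  have key : ∀ᵐ x ∂μ, ∑ i, ‖(b i : Lp ℂ 2 μ) x‖ ^ 2 ≤ M ^ 2 := by
    have h1 : ∀ᵐ x ∂μ, ∀ k : ℕ,
        ‖∑ i, (TopologicalSpace.denseSeq (EuclideanSpace ℂ (Fin n)) k) i * (b i : Lp ℂ 2 μ) x‖ ≤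
          M * ‖TopologicalSpace.denseSeq (EuclideanSpace ℂ (Fin n)) k‖ := by
      rw [ae_all_iff]
      intro k
      set c := TopologicalSpace.denseSeq (EuclideanSpace ℂ (Fin n)) k
      have h2 := hM (b.repr.symm c : S) (Submodule.coe_mem _)
      have h3 : ((b.repr.symm c : S) : Lp ℂ 2 μ) = ∑ i, c i • (b i : Lp ℂ 2 μ) := by
        rw [← b.sum_repr_symm c]
        simp
      have h4 : ‖((b.repr.symm c : S) : Lp ℂ 2 μ)‖ = ‖c‖ := by
        rw [← Submodule.coe_norm, LinearIsometryEquiv.norm_map]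
      rw [h4] at h2
      have h5 : ∀ᵐ x ∂μ, (∑ i, c i • (b i : Lp ℂ 2 μ) : Lp ℂ 2 μ) x
          = ∑ i, c i * (b i : Lp ℂ 2 μ) x := by
        have h6 := Lp.coeFn_finsetSum (Finset.univ) (fun i => c i • (b i : Lp ℂ 2 μ))
        have h7 : ∀ᵐ x ∂μ, ∀ i, (c i • (b i : Lp ℂ 2 μ) : Lp ℂ 2 μ) x = c i * (b i : Lp ℂ 2 μ) x := by
          rw [ae_all_iff]
          intro i
          filter_upwards [Lp.coeFn_smul (c i) (b i : Lp ℂ 2 μ)] with x hx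
          simpa using hx
        filter_upwards [h6, h7] with x hx hx'
        rw [hx]
        simp [hx']
      filter_upwards [h2, h5] with x hx hx'
      rw [← hx', ← h3]
      exact hx
    filter_upwards [h1] with x hx
    have h2 : ∀ c : EuclideanSpace ℂ (Fin n), ‖∑ i, c i * (b i : Lp ℂ 2 μ) x‖ ≤ M * ‖c‖ := by
      intro c
      have hcl : IsClosed {c : EuclideanSpace ℂ (Fin n) |
          ‖∑ i, c i * (b i : Lp ℂ 2 μ) x‖ ≤ M * ‖c‖} :=
        isClosed_le (by fun_prop) (by fun_prop)
      have := hcl.closure_subset_iff.2 (Set.range_subset_iff.2 hx)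
      rw [(TopologicalSpace.denseRange_denseSeq _).closure_eq] at this
      exact this (Set.mem_univ c)
    -- The extremal coefficients at `x`.
    have h3 := h2 (WithLp.toLp 2 fun i => conj ((b i : Lp ℂ 2 μ) x))
    set A := ∑ i, ‖(b i : Lp ℂ 2 μ) x‖ ^ 2 with hA
    have hA0 : 0 ≤ A := by positivity
    have h4 : ∑ i, conj ((b i : Lp ℂ 2 μ) x) * (b i : Lp ℂ 2 μ) x = (A : ℂ) := by
      rw [hA]; push_cast
      exact Finset.sum_congr rfl fun i _ => Complex.conj_mul' _
    simp only [h4, Complex.norm_real, EuclideanSpace.norm_eq, RCLike.norm_conj] at h3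
    rw [← hA, Real.norm_of_nonneg hA0] at h3
    have h5 := Real.sq_sqrt hA0
    have h6 := Real.sqrt_nonneg A
    nlinarith [sq_nonneg (M - √A)]
  have hint : ∀ i, Integrable (fun x => ‖(b i : Lp ℂ 2 μ) x‖ ^ 2) μ := fun i =>
    (Lp.memLp (b i : Lp ℂ 2 μ)).norm.integrable_sq
  have h1 : ∀ i, ∫ x, ‖(b i : Lp ℂ 2 μ) x‖ ^ 2 ∂μ = 1 := by
    intro i
    have h2 : ‖(b i : Lp ℂ 2 μ)‖ = 1 := b.orthonormal.1 i
    have h3 := L2.inner_def (𝕜 := ℂ) (b i : Lp ℂ 2 μ) (b i : Lp ℂ 2 μ)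
    rw [inner_self_eq_norm_sq_to_K, h2] at h3
    have h4 : ∀ x, inner ℂ ((b i : Lp ℂ 2 μ) x) ((b i : Lp ℂ 2 μ) x)
        = ((‖(b i : Lp ℂ 2 μ) x‖ ^ 2 : ℝ) : ℂ) := by
      intro x
      rw [inner_self_eq_norm_sq_to_K]; simp
    simp only [h4] at h3
    rw [integral_complex_ofReal] at h3
    have := congrArg Complex.re h3
    simpa using this.symm
  have hsupp : ∀ᵐ x ∂μ, x ∉ Ω → ∀ i, (b i : Lp ℂ 2 μ) x = 0 := by
    have : ∀ᵐ x ∂μ, ∀ i, x ∉ Ω → (b i : Lp ℂ 2 μ) x = 0 :=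
      ae_all_iff.2 fun i => hS _ (Submodule.coe_mem _)
    filter_upwards [this] with x hx hxΩ i using hx i hxΩ
  calc (n : ℝ) = ∑ i : Fin n, ∫ x, ‖(b i : Lp ℂ 2 μ) x‖ ^ 2 ∂μ := by simp [h1]
    _ = ∫ x, ∑ i, ‖(b i : Lp ℂ 2 μ) x‖ ^ 2 ∂μ := (integral_finsetSum _ fun i _ => hint i).symm
    _ ≤ ∫ x, Ω.indicator (fun _ => M ^ 2) x ∂μ := by
        refine integral_mono_ae (integrable_finsetSum _ fun i _ => hint i)
          ((integrable_indicator_iff hΩ).2 (integrableOn_const hΩ')) ?_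
        filter_upwards [key, hsupp] with x hx hx'
        by_cases hxΩ : x ∈ Ω
        · simpa [hxΩ] using hx
        · simp [hxΩ, hx' hxΩ]
    _ = M ^ 2 * μ.real Ω := by
        rw [integral_indicator_const _ hΩ, smul_eq_mul, mul_comm]

variable {V : Type*} [NormedAddCommGroup V] [InnerProductSpace ℝ V] [FiniteDimensional ℝ V]
  [MeasurableSpace V] [BorelSpace V]

/-- Finitely many translates of a set of finite measure by multiples of a small nonzero vector
cover hardly more than the set itself. -/
theorem exists_measure_iUnion_translates_le [Nontrivial V] {E : Set V} (hE : MeasurableSet E)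
    (hE' : volume E ≠ ⊤) (n : ℕ) :
    ∃ h : V, h ≠ 0 ∧ volume (⋃ j : Fin n, (fun x => x - ((j : ℕ) : ℝ) • h) ⁻¹' E) ≤
      volume E + 1 := by
  obtain ⟨ε, hε0, hε⟩ : ∃ ε : ℝ≥0∞, ε ≠ 0 ∧ n * ε ≤ 1 / 2 := by
    refine ⟨(1 / 2) / (n + 1), by simp, ?_⟩
    rw [← mul_div_assoc]
    refine ENNReal.div_le_of_le_mul ?_
    rw [mul_comm]
    gcongr
    exact le_self_add
  obtain ⟨K, hKE, hK, hKε⟩ := hE.exists_isCompact_sdiff_lt hE' hε0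
  have hlim := tendsto_measure_cthickening_of_isCompact (μ := (volume : Measure V)) hK
  have hlt : volume K < volume K + 1 / 2 :=
    ENNReal.lt_add_right hK.measure_lt_top.ne (by simp)
  obtain ⟨δ, hδ, hδ0⟩ := (((hlim.eventually_lt_const hlt).filter_mono nhdsWithin_le_nhds).and
    (self_mem_nhdsWithin (s := Set.Ioi (0 : ℝ)))).exists
  replace hδ0 : 0 < δ := hδ0
  obtain ⟨h, hh⟩ := exists_norm_eq V (c := δ / (n + 1)) (by positivity)
  refine ⟨h, ?_, ?_⟩
  · rw [← norm_pos_iff, hh]; positivity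
  have hsub : (⋃ j : Fin n, (fun x => x - ((j : ℕ) : ℝ) • h) ⁻¹' E) ⊆
      Metric.cthickening δ K ∪ ⋃ j : Fin n, (fun x => x - ((j : ℕ) : ℝ) • h) ⁻¹' (E \ K) := by
    intro x hx
    obtain ⟨j, hj⟩ := Set.mem_iUnion.1 hx
    by_cases hxK : x - ((j : ℕ) : ℝ) • h ∈ K
    · refine Or.inl (Metric.mem_cthickening_of_dist_le x _ δ K hxK ?_)
      rw [dist_eq_norm, sub_sub_cancel, norm_smul, hh, Real.norm_natCast]
      have : ((j : ℕ) : ℝ) ≤ n + 1 := by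
        have := j.2.le
        have : ((j : ℕ) : ℝ) ≤ n := by exact_mod_cast this
        linarith
      rw [mul_div_assoc', div_le_iff₀ (by positivity), mul_comm]
      gcongr
    · exact Or.inr (Set.mem_iUnion.2 ⟨j, hj, hxK⟩)
  calc _ ≤ volume (Metric.cthickening δ K ∪
        ⋃ j : Fin n, (fun x => x - ((j : ℕ) : ℝ) • h) ⁻¹' (E \ K)) := measure_mono hsub
    _ ≤ volume (Metric.cthickening δ K) +
        ∑ j : Fin n, volume ((fun x => x - ((j : ℕ) : ℝ) • h) ⁻¹' (E \ K)) :=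
      (measure_union_le _ _).trans (by gcongr; exact measure_iUnion_fintype_le _ _)
    _ ≤ (volume E + 1 / 2) + ∑ j : Fin n, ε := by
      gcongr with j
      · exact hδ.le.trans (by gcongr)
      · rw [(measurePreserving_sub_right volume _).measure_preimage
          (hE.diff hK.measurableSet).nullMeasurableSet]
        exact hKε.le
    _ ≤ (volume E + 1 / 2) + 1 / 2 := by gcongr; simpa using hε
    _ = volume E + 1 := by rw [add_assoc, ENNReal.add_halves]

/-- If `f` lives on `E` and `𝓕 f` on `Ω`, both of finite measure, then `‖𝓕 f‖_∞ ≤ ‖f‖₁`,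
`‖f‖₁ ≤ |E| ‖f‖_∞`, `‖f‖_∞ ≤ ‖𝓕 f‖₁` and `‖𝓕 f‖₁ ≤ |Ω|^{1/2} ‖𝓕 f‖₂` combine. -/
theorem enorm_fourier_le_of_ae_eq_zero_off {f : V → ℂ} (hf : Integrable f) {E Ω : Set V}
    (hE : MeasurableSet E) (hΩ : MeasurableSet Ω) (hf' : Integrable (𝓕 f))
    (hfE : ∀ᵐ x, x ∉ E → f x = 0) (hfΩ : ∀ᵐ x, x ∉ Ω → 𝓕 f x = 0) (ξ : V) :
    ‖𝓕 f ξ‖ₑ ≤ eLpNorm (𝓕 f) 2 volume * volume Ω ^ (1 / 2 : ℝ) * volume E := by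
  have h1 : ‖𝓕 f ξ‖ₑ ≤ eLpNorm f 1 volume := by
    rw [eLpNorm_one_eq_lintegral_enorm, ← ofReal_integral_norm_eq_lintegral_enorm hf,
      ← ofReal_norm]
    exact ENNReal.ofReal_le_ofReal (norm_fourier_le ξ)
  have h2 : eLpNorm f 1 volume ≤ eLpNorm (𝓕 f) 1 volume * volume E := by
    rw [eLpNorm_eq_restrict_of_ae_eq_zero_off hE hfE, eLpNorm_one_eq_lintegral_enorm,
      ← setLIntegral_const]
    refine lintegral_mono_ae (ae_restrict_of_ae ?_)
    filter_upwards [ae_eq_fourierInv_fourier hf hf'] with x hx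
    rw [hx, eLpNorm_one_eq_lintegral_enorm, ← ofReal_integral_norm_eq_lintegral_enorm hf',
      ← ofReal_norm]
    exact ENNReal.ofReal_le_ofReal (norm_fourierInv_le x)
  have h3 : eLpNorm (𝓕 f) 1 volume ≤ eLpNorm (𝓕 f) 2 volume * volume Ω ^ (1 / 2 : ℝ) := by
    rw [eLpNorm_eq_restrict_of_ae_eq_zero_off hΩ hfΩ, eLpNorm_eq_restrict_of_ae_eq_zero_off hΩ hfΩ]
    have := eLpNorm_le_eLpNorm_mul_rpow_measure_univ (μ := volume.restrict Ω) (f := 𝓕 f)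
      (p := 1) (q := 2) (by norm_num) (continuous_fourier hf).aestronglyMeasurable
    refine this.trans (le_of_eq ?_)
    rw [Measure.restrict_apply_univ]
    norm_num
  exact h1.trans (h2.trans (by gcongr))

/-- A hyperplane `⟪h, ξ⟫ = a` is a null set. -/
theorem volume_setOf_inner_eq {h : V} (hh : h ≠ 0) (a : ℝ) :
    volume {ξ : V | ⟪h, ξ⟫_ℝ = a} = 0 := by
  let s : AffineSubspace ℝ V := AffineSubspace.mk' ((a / ‖h‖ ^ 2) • h) (ℝ ∙ h)ᗮ
  have hn : ‖h‖ ^ 2 ≠ 0 := by positivity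
  have hs : {ξ : V | ⟪h, ξ⟫_ℝ = a} = s := by
    ext ξ
    simp only [Set.mem_ofPred_eq, SetLike.mem_coe, s, AffineSubspace.mem_mk', vsub_eq_sub,
      Submodule.mem_orthogonal_singleton_iff_inner_right, inner_sub_right, inner_smul_right,
      real_inner_self_eq_norm_sq, div_mul_cancel₀ a hn, sub_eq_zero]
  rw [hs]
  refine Measure.addHaar_affineSubspace _ _ fun htop => hn ?_
  have h1 : ∀ ξ : V, ⟪h, ξ⟫_ℝ = a := fun ξ => by
    have : ξ ∈ (s : Set V) := by rw [htop]; trivial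
    rwa [← hs] at this
  have h2 := h1 0
  have h3 := h1 h
  rw [inner_zero_right] at h2
  rw [← real_inner_self_eq_norm_sq, h3, ← h2]

theorem volume_setOf_fourierChar_inner_eq {h : V} (hh : h ≠ 0) (c : ℂ) :
    volume {ξ : V | (Real.fourierChar (-⟪h, ξ⟫_ℝ) : ℂ) = c} = 0 := by
  by_cases hc : ∃ a : ℝ, (Real.fourierChar a : ℂ) = c
  · obtain ⟨a, rfl⟩ := hc
    refine measure_mono_null (t := ⋃ k : ℤ, {ξ : V | ⟪h, ξ⟫_ℝ = -(a + k)}) ?_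
      (measure_iUnion_null fun k => volume_setOf_inner_eq hh _)
    intro ξ hξ
    simp only [Set.mem_ofPred_eq, Real.fourierChar_apply] at hξ
    obtain ⟨k, hk⟩ := Complex.exp_eq_exp_iff_exists_int.1 hξ
    refine Set.mem_iUnion.2 ⟨k, ?_⟩
    have hpi : (2 * Real.pi * Complex.I : ℂ) ≠ 0 := Complex.two_pi_I_ne_zero
    have : ((-⟪h, ξ⟫_ℝ : ℝ) : ℂ) = ((a + k : ℝ) : ℂ) := by
      apply mul_left_cancel₀ hpi
      push_cast at hk ⊢
      linear_combination hk
    have := Complex.ofReal_injective this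
    simp only [Set.mem_ofPred_eq]
    linarith
  · have : {ξ : V | (Real.fourierChar (-⟪h, ξ⟫_ℝ) : ℂ) = c} = ∅ := by
      ext ξ
      simp only [Set.mem_ofPred_eq, Set.mem_empty_iff_false, iff_false]
      exact fun hξ => hc ⟨_, hξ⟩
    rw [this, measure_empty]

/-- A nonzero trigonometric polynomial in the direction `h` vanishes only on a null set. -/
theorem ae_sum_mul_fourierChar_pow_ne_zero {h : V} (hh : h ≠ 0) {n : ℕ} {c : Fin n → ℂ}
    (hc : c ≠ 0) :
    ∀ᵐ ξ : V, ∑ j, c j * (Real.fourierChar (-⟪h, ξ⟫_ℝ) : ℂ) ^ (j : ℕ) ≠ 0 := by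
  let p : Polynomial ℂ := ∑ j : Fin n, Polynomial.monomial (j : ℕ) (c j)
  have hp : p ≠ 0 := by
    obtain ⟨j, hj⟩ := Function.ne_iff.1 hc
    intro hp
    apply hj
    have := congrArg (fun q => Polynomial.coeff q (j : ℕ)) hp
    simpa [p, Polynomial.finsetSum_coeff, Polynomial.coeff_monomial, Fin.val_inj] using this
  have h1 : ∀ᵐ ξ : V, ∀ r ∈ p.roots.toFinset, (Real.fourierChar (-⟪h, ξ⟫_ℝ) : ℂ) ≠ r := by
    rw [Filter.eventually_all_finset]
    intro r _
    rw [ae_iff]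
    simpa using volume_setOf_fourierChar_inner_eq hh r
  filter_upwards [h1] with ξ hξ hzero
  refine hξ _ ?_ rfl
  rw [Multiset.mem_toFinset, Polynomial.mem_roots hp, Polynomial.IsRoot]
  simpa [p, Polynomial.eval_finsetSum] using hzero

/-- **Benedicks' theorem**: an integrable function and its Fourier transform cannot both live on
sets of finite measure, unless the function is zero. -/
theorem ae_eq_zero_of_fourier_ae_eq_zero_off [Nontrivial V] {f : V → ℂ} (hf : Integrable f)
    {E Ω : Set V} (hE : MeasurableSet E) (hΩ : MeasurableSet Ω) (hE' : volume E ≠ ⊤)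
    (hΩ' : volume Ω ≠ ⊤) (hfE : ∀ᵐ x, x ∉ E → f x = 0) (hfΩ : ∀ᵐ x, x ∉ Ω → 𝓕 f x = 0) :
    f =ᵐ[volume] 0 := by
  by_contra hne
  -- `n` exceeds the dimension bound for the sets `Ω` and `E₁`, where `|E₁| ≤ |E| + 1`.
  have hne' : ¬ 𝓕 f =ᵐ[volume] 0 := fun h => hne (ae_eq_zero_of_fourier_ae_eq_zero hf h)
  obtain ⟨n, hn⟩ := exists_nat_gt ((volume.real Ω ^ (1 / 2 : ℝ) * (volume.real E + 1)) ^ 2 *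
    volume.real Ω)
  obtain ⟨h, hh, hE1⟩ := exists_measure_iUnion_translates_le hE hE' n
  set E₁ := ⋃ j : Fin n, (fun x => x - ((j : ℕ) : ℝ) • h) ⁻¹' E with hE₁
  have hE₁m : MeasurableSet E₁ := MeasurableSet.iUnion fun j =>
    hE.preimage (measurable_id.sub_const _)
  -- `T c` is a combination of translates of `f`, whose Fourier transform is `𝓕 f` times the
  -- trigonometric polynomial `q c`.
  let T : (Fin n → ℂ) → V → ℂ := fun c x => ∑ j, c j * f (x - ((j : ℕ) : ℝ) • h)
  let q : (Fin n → ℂ) → V → ℂ := fun c ξ =>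
    ∑ j, c j * (Real.fourierChar (-⟪h, ξ⟫_ℝ) : ℂ) ^ (j : ℕ)
  have hTint : ∀ c, Integrable (T c) := fun c =>
    integrable_finsetSum _ fun j _ => (hf.comp_sub_right _).const_mul _
  have hTE : ∀ c, ∀ᵐ x, x ∉ E₁ → T c x = 0 := by
    intro c
    have h1 : ∀ᵐ x, ∀ j : Fin n, x - ((j : ℕ) : ℝ) • h ∉ E → f (x - ((j : ℕ) : ℝ) • h) = 0 :=
      ae_all_iff.2 fun j => (measurePreserving_sub_right volume _).quasiMeasurePreserving.ae hfE
    filter_upwards [h1] with x hx hxE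
    refine Finset.sum_eq_zero fun j _ => ?_
    rw [hx j, mul_zero]
    exact fun hxj => hxE (Set.mem_iUnion.2 ⟨j, hxj⟩)
  have hTF : ∀ c ξ, 𝓕 (T c) ξ = q c ξ * 𝓕 f ξ := by
    intro c ξ
    have h1 : ∀ j : Fin n, ∫ x, (Real.fourierChar (-⟪x, ξ⟫_ℝ) : ℂ) * f (x - ((j : ℕ) : ℝ) • h)
        = (Real.fourierChar (-⟪h, ξ⟫_ℝ) : ℂ) ^ (j : ℕ) * 𝓕 f ξ := by
      intro j
      rw [← integral_add_right_eq_self _ (((j : ℕ) : ℝ) • h), Real.fourier_eq,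
        ← integral_const_mul]
      congr 1; ext x
      rw [add_sub_cancel_right, Circle.smul_def, smul_eq_mul, ← mul_assoc]
      congr 1
      simp only [Real.fourierChar_apply, ← Complex.exp_nat_mul, ← Complex.exp_add, inner_add_left,
        inner_smul_left]
      congr 1
      push_cast
      simp
      ring
    rw [Real.fourier_eq]
    simp only [T, q, Circle.smul_def, smul_eq_mul, Finset.mul_sum, Finset.sum_mul]
    rw [integral_finsetSum]
    · refine Finset.sum_congr rfl fun j _ => ?_
      rw [mul_assoc, ← h1 j, ← integral_const_mul]
      congr 1; ext x; ring
    · intro j _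
      have := (Real.fourierIntegral_convergent_iff (μ := volume) ξ).2
        ((hf.comp_sub_right (((j : ℕ) : ℝ) • h)).const_mul (c j))
      simpa [Circle.smul_def] using this
  have hFΩ : ∀ c, ∀ᵐ ξ, ξ ∉ Ω → 𝓕 (T c) ξ = 0 := by
    intro c
    filter_upwards [hfΩ] with ξ hξ hξΩ
    rw [hTF, hξ hξΩ, mul_zero]
  have hmem : ∀ c (p : ℝ≥0∞), MemLp (𝓕 (T c)) p volume := by
    intro c p
    have h1 : MemLp (𝓕 (T c)) p (volume.restrict Ω) := by
      have : IsFiniteMeasure (volume.restrict Ω) := ⟨by simpa using hΩ'.lt_top⟩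
      exact MemLp.of_bound (continuous_fourier (hTint c)).aestronglyMeasurable _
        (Filter.Eventually.of_forall fun ξ => norm_fourier_le ξ)
    refine ⟨(continuous_fourier (hTint c)).aestronglyMeasurable, ?_⟩
    rw [eLpNorm_eq_restrict_of_ae_eq_zero_off hΩ (hFΩ c)]
    exact h1.2
  let Λ : (Fin n → ℂ) →ₗ[ℂ] Lp ℂ 2 (volume : Measure V) :=
    { toFun := fun c => (hmem c 2).toLp _
      map_add' := by
        intro c c'
        rw [← MemLp.toLp_add]
        congr 1
        ext ξ
        simp only [hTF, Pi.add_apply, q, add_mul, Finset.sum_add_distrib]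
      map_smul' := by
        intro a c
        rw [RingHom.id_apply, ← MemLp.toLp_const_smul]
        congr 1
        ext ξ
        simp only [hTF, Pi.smul_apply, q, smul_eq_mul, Finset.mul_sum, Finset.sum_mul, mul_assoc] }
  have hΛ : Function.Injective Λ := by
    rw [injective_iff_map_eq_zero]
    intro c hc
    by_contra hc0
    apply hne'
    have h1 : 𝓕 (T c) =ᵐ[volume] 0 := (MemLp.toLp_eq_toLp_iff (hmem c 2) MemLp.zero).1
      (by rw [MemLp.toLp_zero]; exact hc)
    filter_upwards [h1, ae_sum_mul_fourierChar_pow_ne_zero hh hc0] with ξ h2 h3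
    rw [hTF] at h2
    exact (mul_eq_zero.1 h2).resolve_left h3
  have hrank : Module.finrank ℂ (LinearMap.range Λ) = n := by
    rw [LinearMap.finrank_range_of_inj hΛ]; simp
  have hE₁' : volume E₁ ≠ ⊤ :=
    (hE1.trans_lt (ENNReal.add_lt_top.2 ⟨hE'.lt_top, ENNReal.one_lt_top⟩)).ne
  have hEreal : volume.real E₁ ≤ volume.real E + 1 := by
    have := ENNReal.toReal_mono (by simp [hE']) hE1
    rwa [ENNReal.toReal_add hE' (by simp), ENNReal.toReal_one] at this
  have hbound := finrank_le_of_norm_ae_le (LinearMap.range Λ) hΩ hΩ'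
    (M := volume.real Ω ^ (1 / 2 : ℝ) * volume.real E₁)
    (by
      rintro _ ⟨c, rfl⟩
      filter_upwards [(hmem c 2).coeFn_toLp, hFΩ c] with ξ h1 h2 h3
      exact h1.trans (h2 h3))
    (by
      rintro _ ⟨c, rfl⟩
      filter_upwards [(hmem c 2).coeFn_toLp] with ξ h1
      have h2 := enorm_fourier_le_of_ae_eq_zero_off (hTint c) hE₁m hΩ
        (memLp_one_iff_integrable.1 (hmem c 1)) (hTE c) (hFΩ c) ξ
      have h3 := ENNReal.toReal_mono (ENNReal.mul_ne_top (ENNReal.mul_ne_top (hmem c 2).2.ne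
        (ENNReal.rpow_ne_top_of_nonneg (by norm_num) hΩ')) hE₁') h2
      have h4 : ‖Λ c‖ = (eLpNorm (𝓕 (T c)) 2 volume).toReal := Lp.norm_toLp _ (hmem c 2)
      rw [h4]
      change ‖((hmem c 2).toLp _ : V → ℂ) ξ‖ ≤ _
      rw [h1]
      rw [ENNReal.toReal_mul, ENNReal.toReal_mul, ← ENNReal.toReal_rpow, toReal_enorm] at h3
      calc _ ≤ _ := h3
        _ = _ := by simp only [Measure.real]; ring)
  rw [hrank] at hbound
  have : (volume.real Ω ^ (1 / 2 : ℝ) * volume.real E₁) ^ 2 * volume.real Ω ≤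
      (volume.real Ω ^ (1 / 2 : ℝ) * (volume.real E + 1)) ^ 2 * volume.real Ω := by
    gcongr
  linarith

end Benedicks

/-! ### Pairings of curves in `L²` -/

section Pairing

variable {α : Type*} [MeasurableSpace α] {μ : Measure α}

theorem memLp_of_norm_le_mul {ψ : α → ℂ} (hψ : AEStronglyMeasurable ψ μ) {g : α → ℝ}
    (hg : MemLp g 2 μ) {K : ℝ} (h : ∀ z, ‖ψ z‖ ≤ K * g z) : MemLp ψ 2 μ :=
  (hg.const_mul K).mono' hψ (Filter.Eventually.of_forall h)

theorem integrable_mul_conj {f ψ : α → ℂ} (hf : MemLp f 2 μ) (hψ : MemLp ψ 2 μ) :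
    Integrable (fun z => f z * conj (ψ z)) μ := by
  have : MemLp (fun z => conj (ψ z)) 2 μ := hψ.star
  exact hf.integrable_mul this

theorem integral_mul_conj_eq_inner (u : Lp ℂ 2 μ) {ψ : α → ℂ} (hψ : MemLp ψ 2 μ) :
    ∫ z, u z * conj (ψ z) ∂μ = inner ℂ (hψ.toLp ψ) u := by
  rw [L2.inner_def]
  refine integral_congr_ae ?_
  filter_upwards [hψ.coeFn_toLp] with z hz
  rw [hz, RCLike.inner_apply]

theorem norm_integral_mul_conj_le (u : Lp ℂ 2 μ) {ψ : α → ℂ} (hψ : AEStronglyMeasurable ψ μ)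
    {g : α → ℝ} (hg : MemLp g 2 μ) {K : ℝ} (hK : 0 ≤ K) (h : ∀ z, ‖ψ z‖ ≤ K * g z) :
    ‖∫ z, u z * conj (ψ z) ∂μ‖ ≤ K * (‖u‖ * ‖hg.toLp g‖) := by
  have hψ2 := memLp_of_norm_le_mul hψ hg h
  rw [integral_mul_conj_eq_inner u hψ2]
  have h1 : ‖hψ2.toLp ψ‖ ≤ K * ‖hg.toLp g‖ := by
    refine Lp.norm_le_mul_norm_of_ae_le_mul ?_
    filter_upwards [hψ2.coeFn_toLp, hg.coeFn_toLp] with z h1 h2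
    rw [h1, h2]
    exact (h z).trans (by gcongr; exact Real.le_norm_self _)
  calc _ ≤ ‖hψ2.toLp ψ‖ * ‖u‖ := norm_inner_le_norm _ _
    _ ≤ (K * ‖hg.toLp g‖) * ‖u‖ := by gcongr
    _ = _ := by ring

theorem integral_sub_mul_conj (u v : Lp ℂ 2 μ) {ψ : α → ℂ} (hψ : MemLp ψ 2 μ) :
    ∫ z, (u - v : Lp ℂ 2 μ) z * conj (ψ z) ∂μ
      = ∫ z, u z * conj (ψ z) ∂μ - ∫ z, v z * conj (ψ z) ∂μ := by
  simp only [integral_mul_conj_eq_inner _ hψ, inner_sub_right]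

theorem integral_mul_conj_sub (u : Lp ℂ 2 μ) {ψ χ : α → ℂ} (hψ : MemLp ψ 2 μ)
    (hχ : MemLp χ 2 μ) :
    ∫ z, u z * conj (ψ z - χ z) ∂μ
      = ∫ z, u z * conj (ψ z) ∂μ - ∫ z, u z * conj (χ z) ∂μ := by
  rw [← integral_sub (integrable_mul_conj (Lp.memLp u) hψ) (integrable_mul_conj (Lp.memLp u) hχ)]
  simp only [map_sub, mul_sub]

/-- Expansion of the pairing of two curves around a pair of points, with the second-order term
last. -/
theorem integral_mul_conj_expand (u v : Lp ℂ 2 μ) {ψ χ : α → ℂ} (hψ : MemLp ψ 2 μ)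
    (hχ : MemLp χ 2 μ) :
    ∫ z, u z * conj (ψ z) ∂μ
      = ∫ z, u z * conj (χ z) ∂μ + ∫ z, v z * conj (ψ z - χ z) ∂μ
        + ∫ z, (u - v : Lp ℂ 2 μ) z * conj (ψ z - χ z) ∂μ := by
  have h := integral_sub_mul_conj u v (hψ.sub hχ)
  simp only [Pi.sub_apply] at h
  rw [h, integral_mul_conj_sub u hψ hχ]
  ring

/-- Product rule for the `L²` pairing of a curve `u` that is only weakly differentiable with a curve
`ψ` that is pointwise differentiable and Lipschitz in `L²`. -/
theorem hasDerivAt_integral_mul_conj {u : ℝ → Lp ℂ 2 μ} {s : ℝ} (hu : ContinuousAt u s)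
    {ψ : ℝ → α → ℂ} {ψ' : α → ℂ} {g : α → ℝ} (hg : MemLp g 2 μ)
    (hm : ∀ r, AEStronglyMeasurable (ψ r) μ) (hm' : AEStronglyMeasurable ψ' μ)
    (hb : ∀ r z, ‖ψ r z‖ ≤ g z)
    (hl : ∀ r r' z, ‖ψ r z - ψ r' z‖ ≤ |r - r'| * g z)
    (hd : ∀ z, HasDerivAt (fun r => ψ r z) (ψ' z) s) {D : ℂ}
    (hD : HasDerivAt (fun r => ∫ z, u r z * conj (ψ s z) ∂μ) D s) :
    HasDerivAt (fun r => ∫ z, u r z * conj (ψ r z) ∂μ)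
      (D + ∫ z, u s z * conj (ψ' z) ∂μ) s := by
  have hψ2 : ∀ r, MemLp (ψ r) 2 μ := fun r =>
    memLp_of_norm_le_mul (hm r) hg (K := 1) (by simpa using hb r)
  have hexp : (fun r => ∫ z, u r z * conj (ψ r z) ∂μ) = fun r =>
      ∫ z, u r z * conj (ψ s z) ∂μ + ∫ z, u s z * conj (ψ r z - ψ s z) ∂μ
        + ∫ z, (u r - u s : Lp ℂ 2 μ) z * conj (ψ r z - ψ s z) ∂μ :=
    funext fun r => integral_mul_conj_expand _ _ (hψ2 r) (hψ2 s)
  rw [hexp, ← add_zero (D + _)]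
  refine (hD.add ?_).add ?_
  · refine (hasDerivAt_integral_of_dominated_loc_of_lip (μ := μ) (s := Set.univ) (x₀ := s)
      (bound := fun z => ‖u s z‖ * g z) (F := fun r z => u s z * conj (ψ r z - ψ s z))
      (F' := fun z => u s z * conj (ψ' z)) Filter.univ_mem ?_ ?_ ?_ ?_ ?_ ?_).2
    · exact Filter.Eventually.of_forall fun r =>
        (integrable_mul_conj (Lp.memLp (u s)) ((hψ2 r).sub (hψ2 s))).aestronglyMeasurable
    · exact integrable_mul_conj (Lp.memLp (u s)) ((hψ2 s).sub (hψ2 s))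
    · exact (Lp.aestronglyMeasurable (u s)).mul
        (Complex.continuous_conj.comp_aestronglyMeasurable hm')
    · refine Filter.Eventually.of_forall fun z => LipschitzOnWith.of_dist_le_mul fun r _ r' _ => ?_
      rw [dist_eq_norm, ← mul_sub, ← map_sub, sub_sub_sub_cancel_right, norm_mul, RCLike.norm_conj,
        Real.dist_eq]
      calc _ ≤ ‖u s z‖ * (|r - r'| * g z) := by gcongr; exact hl r r' z
        _ = ‖u s z‖ * g z * |r - r'| := by ring
        _ ≤ _ := by gcongr; exact le_abs_self _
    · exact (Lp.memLp (u s)).norm.integrable_mul hg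
    · refine Filter.Eventually.of_forall fun z => HasDerivAt.const_mul _ ?_
      exact ((hd z).sub_const _).star
  · rw [hasDerivAt_iff_isLittleO]
    have h0 : ∫ z, (u s - u s : Lp ℂ 2 μ) z * conj (ψ s z - ψ s z) ∂μ = 0 := by simp
    simp only [h0, sub_zero, smul_zero]
    have hlim : Filter.Tendsto (fun r => ‖u r - u s‖ * ‖hg.toLp g‖) (nhds s) (nhds 0) := by
      have : Filter.Tendsto (fun r => ‖u r - u s‖) (nhds s) (nhds 0) :=
        tendsto_iff_norm_sub_tendsto_zero.1 hu
      simpa using this.mul_const ‖hg.toLp g‖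
    rw [Asymptotics.isLittleO_iff]
    intro c hc
    filter_upwards [hlim.eventually_lt_const hc] with r hr
    refine (norm_integral_mul_conj_le _ ((hm r).sub (hm s)) hg (abs_nonneg (r - s))
      (hl r s)).trans ?_
    rw [mul_comm, Real.norm_eq_abs]
    gcongr

/-- The pairing of a continuous curve with an `L²`-Lipschitz curve is continuous. -/
theorem tendsto_integral_mul_conj {u : ℝ → Lp ℂ 2 μ} {s : ℝ} {l : Filter ℝ}
    (hl' : l ≤ nhds s) (hu : Filter.Tendsto u l (nhds (u s)))
    {ψ : ℝ → α → ℂ} {g : α → ℝ} (hg : MemLp g 2 μ)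
    (hm : ∀ r, AEStronglyMeasurable (ψ r) μ)
    (hb : ∀ r z, ‖ψ r z‖ ≤ g z)
    (hl : ∀ r r' z, ‖ψ r z - ψ r' z‖ ≤ |r - r'| * g z) :
    Filter.Tendsto (fun r => ∫ z, u r z * conj (ψ r z) ∂μ) l
      (nhds (∫ z, u s z * conj (ψ s z) ∂μ)) := by
  have hψ2 : ∀ r, MemLp (ψ r) 2 μ := fun r =>
    memLp_of_norm_le_mul (hm r) hg (K := 1) (by simpa using hb r)
  rw [tendsto_iff_norm_sub_tendsto_zero]
  have hlim : Filter.Tendsto (fun r => ‖u r - u s‖ * ‖hg.toLp g‖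
      + |r - s| * (‖u s‖ * ‖hg.toLp g‖)) l (nhds 0) := by
    have h1 : Filter.Tendsto (fun r => ‖u r - u s‖) l (nhds 0) :=
      tendsto_iff_norm_sub_tendsto_zero.1 hu
    have h2 : Filter.Tendsto (fun r => |r - s|) l (nhds 0) := by
      have : Filter.Tendsto (fun r => ‖r - s‖) l (nhds 0) :=
        tendsto_iff_norm_sub_tendsto_zero.1 (Filter.tendsto_id.mono_right hl')
      exact this
    simpa using (h1.mul_const ‖hg.toLp g‖).add (h2.mul_const (‖u s‖ * ‖hg.toLp g‖))
  refine squeeze_zero (fun _ => norm_nonneg _) (fun r => ?_) hlim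
  have h1 : ∫ z, u r z * conj (ψ r z) ∂μ - ∫ z, u s z * conj (ψ s z) ∂μ
      = ∫ z, (u r - u s : Lp ℂ 2 μ) z * conj (ψ r z) ∂μ
        + ∫ z, u s z * conj (ψ r z - ψ s z) ∂μ := by
    rw [integral_sub_mul_conj _ _ (hψ2 r), integral_mul_conj_sub _ (hψ2 r) (hψ2 s)]
    ring
  rw [h1]
  refine (norm_add_le _ _).trans (add_le_add ?_ ?_)
  · simpa using norm_integral_mul_conj_le (u r - u s) (hm r) hg zero_le_one
      (by simpa using hb r)
  · exact norm_integral_mul_conj_le _ ((hm r).sub (hm s)) hg (abs_nonneg (r - s)) (hl r s)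

end Pairing

/-! ### The special Hermite operator and its commutator with a cutoff -/

section SpecialHermiteCalculus

variable {d : ℕ}

theorem laplacian_eq_sum_fderiv_fderiv {f : CSpace d → ℂ} (hf : ContDiff ℝ 2 f) (z : CSpace d) :
    (Δ f) z = ∑ k, fderiv ℝ (fun y => fderiv ℝ f y (stdOrthonormalBasis ℝ (CSpace d) k)) z
      (stdOrthonormalBasis ℝ (CSpace d) k) := by
  rw [InnerProductSpace.laplacian_eq_iteratedFDeriv_stdOrthonormalBasis]
  refine Finset.sum_congr rfl fun k _ => ?_
  have h1 : DifferentiableAt ℝ (fderiv ℝ f) z :=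
    (hf.fderiv_right (m := 1) (by norm_num)).differentiable (by norm_num) z
  rw [iteratedFDeriv_two_apply, fderiv_clm_apply h1 (differentiableAt_const _)]
  simp

/-- The rotation field `∑ⱼ (xⱼ ∂/∂yⱼ - yⱼ ∂/∂xⱼ)` is the derivative in the direction `i z`. -/
theorem sum_partial_eq_fderiv_I_smul (f : CSpace d → ℂ) (z : CSpace d) :
    ∑ j : Fin d, (((z j).re : ℂ) * partialY j f z - ((z j).im : ℂ) * partialX j f z)
      = fderiv ℝ f z (Complex.I • z) := by
  have h1 : Complex.I • z = ∑ j : Fin d, ((z j).re • EuclideanSpace.single j Complex.I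
      - (z j).im • EuclideanSpace.single j (1 : ℂ)) := by
    ext i
    simp [Pi.single_apply, Finset.sum_sub_distrib]
    apply Complex.ext <;> simp
  rw [h1, map_sum]
  simp [partialX, partialY]

theorem specialHermite_eq {f : CSpace d → ℂ} (hf : ContDiff ℝ 2 f) (lam : ℝ) (z : CSpace d) :
    specialHermite lam f z =
      -(∑ k, fderiv ℝ (fun y => fderiv ℝ f y (stdOrthonormalBasis ℝ (CSpace d) k)) z
        (stdOrthonormalBasis ℝ (CSpace d) k))
      + ((1 / 4 * lam ^ 2 * ‖z‖ ^ 2 : ℝ) : ℂ) * f z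
      - Complex.I * (lam : ℂ) * fderiv ℝ f z (Complex.I • z) := by
  rw [specialHermite, laplacian_eq_sum_fderiv_fderiv hf, sum_partial_eq_fderiv_I_smul]

/-- The value at `z` of the commutator of `L_λ` with multiplication by `χ`, applied to `φ`. -/
noncomputable def specialHermiteCommutator (lam : ℝ) (χ φ : CSpace d → ℂ) (z : CSpace d) : ℂ :=
  -(∑ k, fderiv ℝ (fun y => fderiv ℝ χ y (stdOrthonormalBasis ℝ (CSpace d) k)) z
        (stdOrthonormalBasis ℝ (CSpace d) k)) * φ z
    - 2 * ∑ k, fderiv ℝ χ z (stdOrthonormalBasis ℝ (CSpace d) k) *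
        fderiv ℝ φ z (stdOrthonormalBasis ℝ (CSpace d) k)
    - Complex.I * (lam : ℂ) * fderiv ℝ χ z (Complex.I • z) * φ z

theorem specialHermite_mul {χ φ : CSpace d → ℂ} (hχ : ContDiff ℝ ∞ χ) (hφ : ContDiff ℝ ∞ φ)
    (lam : ℝ) (z : CSpace d) :
    specialHermite lam (fun y => χ y * φ y) z
      = χ z * specialHermite lam φ z + specialHermiteCommutator lam χ φ z := by
  have hχ1 : Differentiable ℝ χ := hχ.differentiable (by norm_num)
  have hφ1 : Differentiable ℝ φ := hφ.differentiable (by norm_num)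
  have hχ2 : ∀ v, Differentiable ℝ fun y => fderiv ℝ χ y v := fun v =>
    ((hχ.fderiv_right (m := ∞) (by norm_num)).clm_apply contDiff_const).differentiable (by norm_num)
  have hφ2 : ∀ v, Differentiable ℝ fun y => fderiv ℝ φ y v := fun v =>
    ((hφ.fderiv_right (m := ∞) (by norm_num)).clm_apply contDiff_const).differentiable (by norm_num)
  have h1 : ∀ y v, fderiv ℝ (fun y => χ y * φ y) y v
      = χ y * fderiv ℝ φ y v + φ y * fderiv ℝ χ y v := by
    intro y v
    rw [fderiv_fun_mul (hχ1 y) (hφ1 y)]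
    simp
  have h2 : ∀ v, fderiv ℝ (fun y => fderiv ℝ (fun y => χ y * φ y) y v) z v
      = χ z * fderiv ℝ (fun y => fderiv ℝ φ y v) z v
        + 2 * (fderiv ℝ χ z v * fderiv ℝ φ z v)
        + fderiv ℝ (fun y => fderiv ℝ χ y v) z v * φ z := by
    intro v
    simp only [h1]
    rw [fderiv_fun_add ((hχ1 z).fun_mul (hφ2 v z)) ((hφ1 z).fun_mul (hχ2 v z)),
      fderiv_fun_mul (hχ1 z) (hφ2 v z), fderiv_fun_mul (hφ1 z) (hχ2 v z)]
    simp
    ring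
  rw [specialHermite_eq ((hχ.mul hφ).of_le (WithTop.coe_le_coe.2 le_top)),
    specialHermite_eq (hφ.of_le (WithTop.coe_le_coe.2 le_top)), specialHermiteCommutator]
  simp only [h2]
  simp only [h1, Finset.sum_add_distrib, ← Finset.mul_sum, ← Finset.sum_mul]
  ring

/-- Derivatives of a dilated cutoff are `O(1/R)`, and so is the commutator. -/
theorem exists_norm_specialHermiteCommutator_le (lam : ℝ) {χ : CSpace d → ℂ}
    (hχ : ContDiff ℝ ∞ χ) (hc : HasCompactSupport χ) :
    ∃ C : ℝ, 0 ≤ C ∧ ∀ R : ℝ, 1 ≤ R → ∀ (φ : CSpace d → ℂ) (z : CSpace d) (G : ℝ),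
      ‖φ z‖ ≤ G → ‖z‖ * ‖φ z‖ ≤ G → (∀ v, ‖fderiv ℝ φ z v‖ ≤ ‖v‖ * G) →
      ‖specialHermiteCommutator lam (fun y => χ (R⁻¹ • y)) φ z‖ ≤ C / R * G := by
  have hχ1 : Differentiable ℝ χ := hχ.differentiable (by norm_num)
  have hχ2 : ContDiff ℝ ∞ (fderiv ℝ χ) := hχ.fderiv_right (by norm_num)
  obtain ⟨C₁, hC₁⟩ := hc.fderiv (𝕜 := ℝ) |>.exists_bound_of_continuous hχ2.continuous
  have hex : ∀ k, ∃ C, ∀ z, ‖fderiv ℝ (fun y => fderiv ℝ χ y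
      (stdOrthonormalBasis ℝ (CSpace d) k)) z‖ ≤ C := by
    intro k
    have h1 : ContDiff ℝ ∞ (fun y => fderiv ℝ χ y (stdOrthonormalBasis ℝ (CSpace d) k)) :=
      hχ2.clm_apply contDiff_const
    have h2 : HasCompactSupport (fun y => fderiv ℝ χ y (stdOrthonormalBasis ℝ (CSpace d) k)) :=
      hc.fderiv_apply (𝕜 := ℝ) _
    exact (h2.fderiv (𝕜 := ℝ)).exists_bound_of_continuous
      ((h1.fderiv_right (m := ∞) (by norm_num)).continuous)
  choose C₂ hC₂ using hex
  have hC₁0 : 0 ≤ C₁ := (norm_nonneg _).trans (hC₁ 0)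
  have hC₂0 : ∀ k, 0 ≤ C₂ k := fun k => (norm_nonneg _).trans (hC₂ k 0)
  have hS : 0 ≤ ∑ k, C₂ k := Finset.sum_nonneg fun k _ => hC₂0 k
  refine ⟨∑ k, C₂ k + 2 * ∑ _k : Fin (Module.finrank ℝ (CSpace d)), C₁ + |lam| * C₁,
    add_nonneg (add_nonneg hS (by positivity)) (by positivity), ?_⟩
  intro R hR φ z G h1 h2 h3
  have hR0 : 0 < R := by linarith
  have hG : 0 ≤ G := (norm_nonneg _).trans h1
  have hd1 : ∀ y v, fderiv ℝ (fun y => χ (R⁻¹ • y)) y v = R⁻¹ • fderiv ℝ χ (R⁻¹ • y) v := by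
    intro y v
    rw [fderiv_comp_smul]; rfl
  have hd2 : ∀ v, fderiv ℝ (fun y => fderiv ℝ (fun y => χ (R⁻¹ • y)) y v) z v
      = (R⁻¹ * R⁻¹) • fderiv ℝ (fun y => fderiv ℝ χ y v) (R⁻¹ • z) v := by
    intro v
    simp only [hd1]
    have h4 : DifferentiableAt ℝ (fun y => fderiv ℝ χ y v) (R⁻¹ • z) :=
      (hχ2.clm_apply contDiff_const).differentiable (by norm_num) _
    have h5 : DifferentiableAt ℝ (fun y => fderiv ℝ χ (R⁻¹ • y) v) z :=
      h4.comp z (differentiableAt_id.fun_const_smul _)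
    rw [fderiv_fun_const_smul h5, fderiv_comp_smul (f := fun y => fderiv ℝ χ y v), smul_smul]
    rfl
  have hb1 : ∀ k, ‖stdOrthonormalBasis ℝ (CSpace d) k‖ = 1 := fun k =>
    (stdOrthonormalBasis ℝ (CSpace d)).orthonormal.1 k
  have hRi : ‖R⁻¹‖ = R⁻¹ := Real.norm_of_nonneg (by positivity)
  have hRi1 : R⁻¹ ≤ 1 := inv_le_one_of_one_le₀ hR
  have e1 : ∀ k, ‖fderiv ℝ (fun y => fderiv ℝ (fun y => χ (R⁻¹ • y)) y
      (stdOrthonormalBasis ℝ (CSpace d) k)) z (stdOrthonormalBasis ℝ (CSpace d) k)‖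
      ≤ R⁻¹ * C₂ k := by
    intro k
    rw [hd2, norm_smul, norm_mul, hRi]
    have := (fderiv ℝ (fun y => fderiv ℝ χ y (stdOrthonormalBasis ℝ (CSpace d) k))
      (R⁻¹ • z)).le_opNorm (stdOrthonormalBasis ℝ (CSpace d) k)
    rw [hb1, mul_one] at this
    calc R⁻¹ * R⁻¹ * _ ≤ R⁻¹ * 1 * C₂ k := by gcongr; exact this.trans (hC₂ k _)
      _ = _ := by ring
  have e2 : ∀ v, ‖fderiv ℝ (fun y => χ (R⁻¹ • y)) z v‖ ≤ R⁻¹ * (C₁ * ‖v‖) := by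
    intro v
    rw [hd1, norm_smul, hRi]
    gcongr
    exact ((fderiv ℝ χ (R⁻¹ • z)).le_opNorm v).trans (by gcongr; exact hC₁ _)
  rw [specialHermiteCommutator]
  refine (norm_sub_le _ _).trans ?_
  refine (add_le_add_left (norm_sub_le _ _) _).trans ?_
  have t1 : ‖-(∑ k, fderiv ℝ (fun y => fderiv ℝ (fun y => χ (R⁻¹ • y)) y
      (stdOrthonormalBasis ℝ (CSpace d) k)) z (stdOrthonormalBasis ℝ (CSpace d) k)) * φ z‖
      ≤ R⁻¹ * (∑ k, C₂ k) * G := by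
    rw [norm_mul, norm_neg, Finset.mul_sum]
    exact mul_le_mul (norm_sum_le_of_le _ fun k _ => e1 k) h1 (norm_nonneg _)
      (Finset.sum_nonneg fun k _ => mul_nonneg (by positivity) (hC₂0 k))
  have t2 : ‖2 * ∑ k, fderiv ℝ (fun y => χ (R⁻¹ • y)) z (stdOrthonormalBasis ℝ (CSpace d) k) *
        fderiv ℝ φ z (stdOrthonormalBasis ℝ (CSpace d) k)‖
      ≤ R⁻¹ * (2 * ∑ _k : Fin (Module.finrank ℝ (CSpace d)), C₁) * G := by
    rw [norm_mul, Complex.norm_ofNat]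
    have : ‖∑ k, fderiv ℝ (fun y => χ (R⁻¹ • y)) z (stdOrthonormalBasis ℝ (CSpace d) k) *
        fderiv ℝ φ z (stdOrthonormalBasis ℝ (CSpace d) k)‖ ≤
        ∑ _k : Fin (Module.finrank ℝ (CSpace d)), R⁻¹ * C₁ * G := by
      refine norm_sum_le_of_le _ fun k _ => ?_
      rw [norm_mul]
      have h4 := e2 (stdOrthonormalBasis ℝ (CSpace d) k)
      have h5 := h3 (stdOrthonormalBasis ℝ (CSpace d) k)
      rw [hb1, mul_one] at h4
      rw [hb1, one_mul] at h5
      gcongr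
    rw [← Finset.sum_mul, ← Finset.mul_sum] at this
    linarith
  have t3 : ‖Complex.I * (lam : ℂ) * fderiv ℝ (fun y => χ (R⁻¹ • y)) z (Complex.I • z) * φ z‖
      ≤ R⁻¹ * (|lam| * C₁) * G := by
    have h4 := e2 (Complex.I • z)
    rw [norm_smul, Complex.norm_I, one_mul] at h4
    rw [norm_mul, norm_mul, norm_mul, Complex.norm_I, one_mul, Complex.norm_real, Real.norm_eq_abs]
    calc _ ≤ |lam| * (R⁻¹ * (C₁ * ‖z‖)) * ‖φ z‖ := by gcongr
      _ = R⁻¹ * (|lam| * C₁) * (‖z‖ * ‖φ z‖) := by ring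
      _ ≤ _ := by gcongr
  refine (add_le_add (add_le_add t1 t2) t3).trans (le_of_eq ?_)
  rw [div_eq_mul_inv]
  ring

end SpecialHermiteCalculus

/-! ### Weak solutions tested against classical solutions -/

section Duality

variable {d : ℕ}

theorem continuous_specialHermite {f : CSpace d → ℂ} (hf : ContDiff ℝ ∞ f) (lam : ℝ) :
    Continuous (specialHermite lam f) := by
  have h1 : ContDiff ℝ ∞ (fderiv ℝ f) := hf.fderiv_right (by norm_num)
  have h2 : ∀ v, Continuous (fderiv ℝ (fun y => fderiv ℝ f y v)) := fun v =>
    ((h1.clm_apply contDiff_const).fderiv_right (m := ∞) (by norm_num)).continuous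
  rw [funext (specialHermite_eq (hf.of_le (WithTop.coe_le_coe.2 le_top)) lam)]
  have h3 : Continuous fun z : CSpace d => fderiv ℝ f z (Complex.I • z) :=
    h1.continuous.clm_apply (continuous_id.const_smul Complex.I)
  have h4 := hf.continuous
  refine ((continuous_finsetSum _ fun k _ => (h2 _).clm_apply continuous_const).neg.add ?_).sub ?_
  · fun_prop
  · fun_prop

/-- A weak solution has constant pairing with any family `φ s` of classical solutions that, together
with its derivatives, is dominated by one square integrable function. The `φ s` need not have
compact support: with a cutoff `χ(z/R)`, the derivative of the pairing with `χ(z/R) φ s` only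
involves the commutator of `L_λ` and the cutoff, which is `O(1/R)`. -/
theorem integral_mul_conj_eq_of_classical_solution {lam : ℝ} {u₀ : L2CSpace d} {u : ℝ → L2CSpace d}
    (hu : IsSpecialHermiteSchrodingerSolution lam u₀ u) {φ : ℝ → CSpace d → ℂ} {g : CSpace d → ℝ}
    (hg : MemLp g 2 volume) (hφ : ∀ s, ContDiff ℝ ∞ (φ s))
    (h0 : ∀ s z, ‖φ s z‖ ≤ g z) (h1 : ∀ s z, ‖z‖ * ‖φ s z‖ ≤ g z)
    (h2 : ∀ s z v, ‖fderiv ℝ (φ s) z v‖ ≤ ‖v‖ * g z)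
    (h3 : ∀ s z, ‖specialHermite lam (φ s) z‖ ≤ g z)
    (hd : ∀ s z, HasDerivAt (fun r => φ r z) (-Complex.I * specialHermite lam (φ s) z) s)
    {t : ℝ} (ht : 0 < t) :
    ∫ z, u t z * conj (φ t z) = ∫ z, u₀ z * conj (φ 0 z) := by
  have hg0 : ∀ z, 0 ≤ g z := fun z => (norm_nonneg _).trans (h0 0 z)
  have hlip : ∀ r r' z, ‖φ r z - φ r' z‖ ≤ |r - r'| * g z := by
    intro r r' z
    have := Convex.norm_image_sub_le_of_norm_hasDerivWithin_le (s := Set.univ)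
      (f := fun r => φ r z) (C := g z) (x := r') (y := r)
      (fun s _ => (hd s z).hasDerivWithinAt)
      (fun s _ => by rw [norm_mul, norm_neg, Complex.norm_I, one_mul]; exact h3 s z)
      convex_univ (Set.mem_univ _) (Set.mem_univ _)
    rwa [mul_comm, Real.norm_eq_abs] at this
  have hmeas : ∀ r, AEStronglyMeasurable (φ r) volume := fun r =>
    (hφ r).continuous.aestronglyMeasurable
  -- Smoothly cut off with `χ(z/R)`, where `χ = 1` near the origin.
  let B : ContDiffBump (0 : CSpace d) := ⟨1, 2, one_pos, one_lt_two⟩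
  let χ : CSpace d → ℂ := fun z => (B z : ℂ)
  have hχ : ContDiff ℝ ∞ χ := Complex.ofRealCLM.contDiff.comp B.contDiff
  have hχc : HasCompactSupport χ :=
    B.hasCompactSupport.comp_left (g := fun x : ℝ => (x : ℂ)) rfl
  have hχ1 : ∀ z, ‖χ z‖ ≤ 1 := fun z => by
    simp only [χ, Complex.norm_real, Real.norm_eq_abs, abs_of_nonneg B.nonneg]
    exact B.le_one
  obtain ⟨C, hC0, hC⟩ := exists_norm_specialHermiteCommutator_le lam hχ hχc
  have hsub : Set.Icc (0 : ℝ) t ⊆ Set.Ici 0 := fun x hx => hx.1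
  obtain ⟨M, hM⟩ := isCompact_Icc.exists_bound_of_continuousOn (hu.continuousOn.mono hsub)
  have hM0 : 0 ≤ M := (norm_nonneg _).trans (hM 0 ⟨le_rfl, ht.le⟩)
  let F : ℝ → ℝ → ℂ := fun R s => ∫ z, u s z * conj (χ (R⁻¹ • z) * φ s z)
  have hF : ∀ R : ℝ, 1 ≤ R → ∀ s ∈ Set.Ioc 0 t, ∃ D, HasDerivAt (F R) D s ∧
      ‖D‖ ≤ C / R * (M * ‖hg.toLp g‖) := by
    intro R hR s hs
    have hR0 : 0 < R := by linarith
    have hχR : ContDiff ℝ ∞ (fun z : CSpace d => χ (R⁻¹ • z)) :=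
      hχ.comp (contDiff_const_smul R⁻¹)
    have hχRc : HasCompactSupport (fun z : CSpace d => χ (R⁻¹ • z)) :=
      hχc.comp_smul (inv_ne_zero hR0.ne')
    have hsm : ∀ r, ContDiff ℝ ∞ (fun z => χ (R⁻¹ • z) * φ r z) := fun r => hχR.mul (hφ r)
    have hL : Continuous (specialHermite lam (φ s)) := continuous_specialHermite (hφ s) lam
    have hχφ : Continuous (fun z => χ (R⁻¹ • z) * specialHermite lam (φ s) z) :=
      hχR.continuous.mul hL
    have hLm := continuous_specialHermite (hsm s) lam
    have hcomm : ∀ z, specialHermiteCommutator lam (fun y => χ (R⁻¹ • y)) (φ s) z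
        = specialHermite lam (fun z => χ (R⁻¹ • z) * φ s z) z
          - χ (R⁻¹ • z) * specialHermite lam (φ s) z := fun z => by
      rw [specialHermite_mul hχR (hφ s)]; ring
    have hcm : Continuous (specialHermiteCommutator lam (fun y => χ (R⁻¹ • y)) (φ s)) := by
      rw [funext hcomm]; exact hLm.sub hχφ
    have hcb : ∀ z, ‖specialHermiteCommutator lam (fun y => χ (R⁻¹ • y)) (φ s) z‖ ≤ C / R * g z :=
      fun z => hC R hR _ _ _ (h0 s z) (h1 s z) (h2 s z)
    have hlm : MemLp (fun z => χ (R⁻¹ • z) * specialHermite lam (φ s) z) 2 volume := by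
      refine memLp_of_norm_le_mul hχφ.aestronglyMeasurable hg (K := 1) fun z => ?_
      rw [norm_mul]
      exact mul_le_mul (hχ1 _) (h3 s z) (norm_nonneg _) zero_le_one
    have hcm2 := memLp_of_norm_le_mul hcm.aestronglyMeasurable hg hcb
    have hder := hasDerivAt_integral_mul_conj (u := u) (s := s)
      (hu.continuousOn.continuousAt (Ici_mem_nhds hs.1))
      (ψ := fun r z => χ (R⁻¹ • z) * φ r z)
      (ψ' := fun z => χ (R⁻¹ • z) * (-Complex.I * specialHermite lam (φ s) z)) hg
      (fun r => (hsm r).continuous.aestronglyMeasurable)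
      (hχR.continuous.mul (continuous_const.mul hL)).aestronglyMeasurable
      (fun r z => by
        rw [norm_mul]
        calc _ ≤ 1 * g z := mul_le_mul (hχ1 _) (h0 r z) (norm_nonneg _) zero_le_one
          _ = _ := one_mul _)
      (fun r r' z => by
        rw [← mul_sub, norm_mul]
        calc _ ≤ 1 * (|r - r'| * g z) :=
              mul_le_mul (hχ1 _) (hlip r r' z) (norm_nonneg _) zero_le_one
          _ = _ := one_mul _)
      (fun z => (hd s z).const_mul _)
      (hu.equation _ (hsm s) hχRc.mul_right s hs.1)
    refine ⟨_, hder, ?_⟩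
    -- The two contributions combine to the pairing with the commutator.
    have e1 : ∀ z, u s z * conj (specialHermite lam (fun z => χ (R⁻¹ • z) * φ s z) z)
        = u s z * conj (χ (R⁻¹ • z) * specialHermite lam (φ s) z)
          + u s z * conj (specialHermiteCommutator lam (fun y => χ (R⁻¹ • y)) (φ s) z) := by
      intro z
      rw [hcomm, map_sub]; ring
    have e2 : ∀ z, u s z * conj (χ (R⁻¹ • z) * (-Complex.I * specialHermite lam (φ s) z))
        = Complex.I * (u s z * conj (χ (R⁻¹ • z) * specialHermite lam (φ s) z)) := by
      intro z
      simp only [map_mul, map_neg, Complex.conj_I]; ring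
    simp only [e1, e2]
    rw [integral_add (integrable_mul_conj (Lp.memLp _) hlm)
      (integrable_mul_conj (Lp.memLp _) hcm2), integral_const_mul]
    have e3 : ∀ a b : ℂ, -Complex.I * (a + b) + Complex.I * a = -Complex.I * b := by
      intro a b; ring
    rw [e3, norm_mul, norm_neg, Complex.norm_I, one_mul]
    refine (norm_integral_mul_conj_le (u s) hcm.aestronglyMeasurable hg (by positivity)
      hcb).trans ?_
    gcongr
    exact hM s ⟨hs.1.le, hs.2⟩
  have hlim : ∀ s, Filter.Tendsto (fun R => F R s) Filter.atTop
      (nhds (∫ z, u s z * conj (φ s z))) := by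
    intro s
    refine tendsto_integral_filter_of_dominated_convergence (fun z => ‖u s z‖ * g z) ?_ ?_
      ((Lp.memLp (u s)).norm.integrable_mul hg) ?_
    · refine Filter.Eventually.of_forall fun R => (Lp.aestronglyMeasurable (u s)).mul
        (Continuous.aestronglyMeasurable ?_)
      exact Complex.continuous_conj.comp
        ((hχ.continuous.comp (continuous_const_smul R⁻¹)).mul (hφ s).continuous)
    · refine Filter.Eventually.of_forall fun R => Filter.Eventually.of_forall fun z => ?_
      rw [norm_mul, RCLike.norm_conj, norm_mul]
      gcongr
      calc _ ≤ 1 * g z := mul_le_mul (hχ1 _) (h0 s z) (norm_nonneg _) zero_le_one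
        _ = _ := one_mul _
    · refine Filter.Eventually.of_forall fun z => ?_
      refine tendsto_const_nhds.congr' ?_
      filter_upwards [Filter.eventually_ge_atTop (max 1 ‖z‖)] with R hR
      have hR1 : 1 ≤ R := (le_max_left _ _).trans hR
      have hRz : ‖z‖ ≤ R := (le_max_right _ _).trans hR
      have : χ (R⁻¹ • z) = 1 := by
        simp only [χ]
        rw [B.one_of_mem_closedBall]
        · simp
        · rw [mem_closedBall_zero_iff, norm_smul, norm_inv, Real.norm_of_nonneg (by linarith),
            inv_mul_le_iff₀ (by linarith)]
          simpa [B] using hRz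
      rw [this, one_mul]
  -- The weak equation holds only for positive times: compare `t` with `ε > 0`, then let `ε → 0`.
  have hconst : ∀ ε ∈ Set.Ioc 0 t,
      ∫ z, u ε z * conj (φ ε z) = ∫ z, u t z * conj (φ t z) := by
    intro ε hε
    have hb : ∀ R : ℝ, 1 ≤ R → ‖F R t - F R ε‖ ≤ C / R * (M * ‖hg.toLp g‖) * ‖t - ε‖ := by
      intro R hR
      have hIcc : ∀ s ∈ Set.Icc ε t, s ∈ Set.Ioc 0 t := fun s hs => ⟨hε.1.trans_le hs.1, hs.2⟩
      choose! D hD hD' using hF R hR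
      exact Convex.norm_image_sub_le_of_norm_hasDerivWithin_le (s := Set.Icc ε t) (f' := D)
        (fun s hs => (hD s (hIcc s hs)).hasDerivWithinAt) (fun s hs => hD' s (hIcc s hs))
        (convex_Icc _ _) ⟨le_rfl, hε.2⟩ ⟨hε.2, le_rfl⟩
    have hz : Filter.Tendsto (fun R : ℝ => C / R * (M * ‖hg.toLp g‖) * ‖t - ε‖) Filter.atTop
        (nhds 0) := by
      simpa using ((tendsto_const_nhds (x := C)).div_atTop
        Filter.tendsto_id).mul_const (M * ‖hg.toLp g‖) |>.mul_const ‖t - ε‖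
    have h4 := le_of_tendsto_of_tendsto ((hlim t).sub (hlim ε)).norm hz
      ((Filter.eventually_ge_atTop 1).mono hb)
    exact (sub_eq_zero.1 (norm_le_zero_iff.1 h4)).symm
  have hcont := tendsto_integral_mul_conj (u := u) (s := 0) (l := nhdsWithin 0 (Set.Ioi 0))
    nhdsWithin_le_nhds
    ((hu.continuousOn 0 Set.self_mem_Ici).tendsto.mono_left
      (nhdsWithin_mono _ Set.Ioi_subset_Ici_self)) hg hmeas h0 hlip
  rw [hu.initial] at hcont
  refine tendsto_nhds_unique (tendsto_const_nhds.congr' ?_) hcont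
  filter_upwards [Ioc_mem_nhdsGT ht] with ε hε using (hconst ε hε).symm

end Duality

/-! ### Gaussian states -/

section CoherentStates

variable {d : ℕ}

theorem inner_I_smul_right_self (z : CSpace d) : ⟪z, Complex.I • z⟫_ℝ = 0 := by
  rw [PiLp.inner_apply]
  refine Finset.sum_eq_zero fun j _ => ?_
  simp [Complex.inner, mul_comm]

theorem inner_complex_smul_left (a : ℂ) (x z : CSpace d) :
    ⟪a • x, z⟫_ℝ = a.re * ⟪x, z⟫_ℝ - a.im * ⟪x, Complex.I • z⟫_ℝ := by
  simp only [PiLp.inner_apply, Finset.mul_sum, ← Finset.sum_sub_distrib]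
  refine Finset.sum_congr rfl fun j _ => ?_
  simp [Complex.inner]
  ring

theorem finrank_real_cspace : Module.finrank ℝ (CSpace d) = 2 * d := by
  rw [(WithLp.linearEquiv 2 ℝ (Fin d → ℂ)).finrank_eq, Module.finrank_pi_fintype]
  simp [mul_comm]

/-- The Gaussian `exp(c - (μ/4)‖z‖² + i w ⟪η, z⟫)`, with complex amplitude `w` of the linear
term. -/
noncomputable def coherentState (μ : ℝ) (c w : ℂ) (η z : CSpace d) : ℂ :=
  Complex.exp (c - ((μ / 4 * ‖z‖ ^ 2 : ℝ) : ℂ) + Complex.I * w * (⟪η, z⟫_ℝ : ℂ))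

variable (μ : ℝ) (c w : ℂ) (η : CSpace d)

theorem contDiff_coherentState : ContDiff ℝ ∞ (coherentState μ c w η) := by
  have h1 : ContDiff ℝ ∞ fun z : CSpace d => ((μ / 4 * ‖z‖ ^ 2 : ℝ) : ℂ) :=
    Complex.ofRealCLM.contDiff.comp (contDiff_const.mul (contDiff_norm_sq ℝ))
  have h2 : ContDiff ℝ ∞ fun z : CSpace d => (⟪η, z⟫_ℝ : ℂ) :=
    Complex.ofRealCLM.contDiff.comp (contDiff_const.inner ℝ contDiff_id)
  exact ((contDiff_const.sub h1).add (contDiff_const.mul h2)).cexp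

theorem fderiv_coherentState (z v : CSpace d) :
    fderiv ℝ (coherentState μ c w η) z v
      = coherentState μ c w η z
        * (-(μ / 2) * (⟪z, v⟫_ℝ : ℂ) + Complex.I * w * (⟪η, v⟫_ℝ : ℂ)) := by
  have h1 : HasFDerivAt (fun z : CSpace d => ((μ / 4 * ‖z‖ ^ 2 : ℝ) : ℂ))
      (Complex.ofRealCLM.comp ((μ / 4) • ((2 : ℝ) • innerSL ℝ z))) z := by
    refine Complex.ofRealCLM.hasFDerivAt.comp z (HasFDerivAt.const_mul ?_ _)
    exact (hasStrictFDerivAt_norm_sq z).hasFDerivAt.congr_fderiv (by ext; simp [two_mul])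
  have h2 : HasFDerivAt (fun z : CSpace d => (⟪η, z⟫_ℝ : ℂ))
      (Complex.ofRealCLM.comp (innerSL ℝ η)) z :=
    Complex.ofRealCLM.hasFDerivAt.comp z (innerSL ℝ η).hasFDerivAt
  have h3 := (((hasFDerivAt_const c z).sub h1).add (h2.const_mul (Complex.I * w))).cexp
  have h4 : HasFDerivAt (coherentState μ c w η) _ z := h3
  rw [h4.fderiv]
  simp [coherentState]
  ring

theorem specialHermite_coherentState {lam : ℝ} (hμ : μ ^ 2 = lam ^ 2) (z : CSpace d) :
    specialHermite lam (coherentState μ c w η) z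
      = coherentState μ c w η z * (μ * d + Complex.I * μ * w * (⟪η, z⟫_ℝ : ℂ)
        + w ^ 2 * (‖η‖ ^ 2 : ℝ) + lam * w * (⟪η, Complex.I • z⟫_ℝ : ℂ)) := by
  have hsm := contDiff_coherentState μ c w η
  rw [specialHermite_eq (hsm.of_le (WithTop.coe_le_coe.2 le_top))]
  have h2 : ∀ v, fderiv ℝ (fun y => fderiv ℝ (coherentState μ c w η) y v) z v
      = coherentState μ c w η z
        * ((-(μ / 2) * (⟪z, v⟫_ℝ : ℂ) + Complex.I * w * (⟪η, v⟫_ℝ : ℂ)) ^ 2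
          - μ / 2 * (⟪v, v⟫_ℝ : ℂ)) := by
    intro v
    simp only [fderiv_coherentState]
    have h1 : HasFDerivAt (fun y : CSpace d =>
        (-(μ / 2) * (⟪y, v⟫_ℝ : ℂ) + Complex.I * w * (⟪η, v⟫_ℝ : ℂ)))
        ((-(μ / 2 : ℂ)) • (Complex.ofRealCLM.comp (innerSL ℝ v))) z := by
      have h5 : HasFDerivAt (fun z : CSpace d => (⟪v, z⟫_ℝ : ℂ))
          (Complex.ofRealCLM.comp (innerSL ℝ v)) z :=
        Complex.ofRealCLM.hasFDerivAt.comp z (innerSL ℝ v).hasFDerivAt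
      have h6 := (h5.const_mul (-(μ / 2 : ℂ))).add_const (Complex.I * w * (⟪η, v⟫_ℝ : ℂ))
      simpa only [real_inner_comm] using h6
    rw [fderiv_fun_mul ((hsm.differentiable (by norm_num)) z) h1.differentiableAt, h1.fderiv]
    simp [fderiv_coherentState]
    ring
  have hp : ∀ x y : CSpace d, ∑ k, (⟪x, stdOrthonormalBasis ℝ (CSpace d) k⟫_ℝ : ℂ)
      * (⟪y, stdOrthonormalBasis ℝ (CSpace d) k⟫_ℝ : ℂ) = (⟪x, y⟫_ℝ : ℂ) := by
    intro x y
    rw [← (stdOrthonormalBasis ℝ (CSpace d)).sum_inner_mul_inner x y]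
    push_cast
    exact Finset.sum_congr rfl fun k _ => by rw [real_inner_comm y]
  have hsum : ∑ k, fderiv ℝ (fun y => fderiv ℝ (coherentState μ c w η) y
      (stdOrthonormalBasis ℝ (CSpace d) k)) z (stdOrthonormalBasis ℝ (CSpace d) k)
      = coherentState μ c w η z * ((μ ^ 2 / 4) * (⟪z, z⟫_ℝ : ℂ)
        - Complex.I * μ * w * (⟪η, z⟫_ℝ : ℂ) - w ^ 2 * (⟪η, η⟫_ℝ : ℂ) - μ * d) := by
    simp only [h2, ← Finset.mul_sum]
    congr 1
    have h7 : ∀ k, (⟪stdOrthonormalBasis ℝ (CSpace d) k,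
        stdOrthonormalBasis ℝ (CSpace d) k⟫_ℝ : ℂ) = 1 := fun k => by
      rw [(stdOrthonormalBasis ℝ (CSpace d)).inner_eq_one]; simp
    simp only [h7]
    rw [← hp z z, ← hp η z, ← hp η η]
    have h8 : (μ * d : ℂ) = ∑ _k : Fin (Module.finrank ℝ (CSpace d)), (μ / 2 : ℂ) := by
      simp [finrank_real_cspace]; ring
    rw [h8]
    simp only [Finset.mul_sum, ← Finset.sum_sub_distrib]
    refine Finset.sum_congr rfl fun k _ => ?_
    linear_combination (w ^ 2 * (⟪η, stdOrthonormalBasis ℝ (CSpace d) k⟫_ℝ : ℂ) ^ 2)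
      * Complex.I_sq
  rw [hsum, fderiv_coherentState, inner_I_smul_right_self, real_inner_self_eq_norm_sq,
    real_inner_self_eq_norm_sq]
  have hμ' : (μ : ℂ) ^ 2 = (lam : ℂ) ^ 2 := by exact_mod_cast hμ
  push_cast
  linear_combination (-(1 / 4) * coherentState μ c w η z * (‖z‖ : ℂ) ^ 2) * hμ'
    - (lam * w * coherentState μ c w η z * (⟪η, Complex.I • z⟫_ℝ : ℂ)) * Complex.I_sq

theorem norm_coherentState (z : CSpace d) :
    ‖coherentState μ c w η z‖ = Real.exp (c.re - μ / 4 * ‖z‖ ^ 2 - w.im * ⟪η, z⟫_ℝ) := by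
  rw [coherentState, Complex.norm_exp]
  congr 1
  simp only [Complex.add_re, Complex.sub_re, Complex.ofReal_re, Complex.mul_re, Complex.I_re,
    Complex.I_im, Complex.mul_im, Complex.ofReal_im]
  ring

theorem norm_coherentState_mul_le (hμ : 0 < μ) {A : ℝ} (hc : c.re ≤ A) (hw : ‖w‖ ≤ 1)
    (z : CSpace d) : (1 + ‖z‖) * ‖coherentState μ c w η z‖
      ≤ Real.exp (A + 2 * (‖η‖ + 1) ^ 2 / μ) * Real.exp (-(μ / 8) * ‖z‖ ^ 2) := by
  rw [norm_coherentState, ← Real.exp_add]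
  have h1 : 1 + ‖z‖ ≤ Real.exp ‖z‖ := by rw [add_comm]; exact Real.add_one_le_exp _
  have h2 : |w.im * ⟪η, z⟫_ℝ| ≤ ‖η‖ * ‖z‖ := by
    rw [abs_mul]
    calc _ ≤ 1 * (‖η‖ * ‖z‖) := mul_le_mul ((Complex.abs_im_le_norm w).trans hw)
          (abs_real_inner_le_norm _ _) (abs_nonneg _) zero_le_one
      _ = _ := one_mul _
  have h3 := neg_le_of_abs_le h2
  -- Half of the Gaussian decay absorbs the linear growth, on completing the square.
  have h4 : (‖η‖ + 1) * ‖z‖ ≤ μ / 8 * ‖z‖ ^ 2 + 2 * (‖η‖ + 1) ^ 2 / μ := by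
    have : μ / 8 * ‖z‖ ^ 2 + 2 * (‖η‖ + 1) ^ 2 / μ - (‖η‖ + 1) * ‖z‖
        = (μ * ‖z‖ - 4 * (‖η‖ + 1)) ^ 2 / (8 * μ) := by
      field_simp; ring
    have h5 : 0 ≤ (μ * ‖z‖ - 4 * (‖η‖ + 1)) ^ 2 / (8 * μ) := by positivity
    linarith
  calc _ ≤ Real.exp ‖z‖ * Real.exp (c.re - μ / 4 * ‖z‖ ^ 2 - w.im * ⟪η, z⟫_ℝ) := by gcongr
    _ = Real.exp (‖z‖ + (c.re - μ / 4 * ‖z‖ ^ 2 - w.im * ⟪η, z⟫_ℝ)) := (Real.exp_add _ _).symm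
    _ ≤ _ := Real.exp_le_exp.2 (by linarith)

theorem memLp_two_exp_neg_mul_norm_sq {a : ℝ} (ha : 0 < a) (K : ℝ) :
    MemLp (fun z : CSpace d => K * Real.exp (-a * ‖z‖ ^ 2)) 2 volume := by
  refine MemLp.const_mul ?_ K
  have hc : Continuous fun z : CSpace d => Real.exp (-a * ‖z‖ ^ 2) := by fun_prop
  rw [memLp_two_iff_integrable_sq hc.aestronglyMeasurable]
  have h := (GaussianFourier.integrable_cexp_neg_mul_sq_norm_add (V := CSpace d)
    (b := (2 * a : ℝ)) (by simpa using ha) 0 0).norm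
  refine h.congr (Filter.Eventually.of_forall fun z => ?_)
  simp only [Complex.norm_exp]
  rw [← Real.exp_nat_mul]
  congr 1
  simp [← Complex.ofReal_pow]
  ring

end CoherentStates

/-! ### Evolution of Gaussian states -/

section Evolution

variable {d : ℕ}

/-- The coherent state `exp(-(|λ|/4)‖z‖² + i⟪ξ, z⟫)`, evolved backwards by the time `τ` under the
special Hermite Schrödinger flow: the state stays Gaussian, its frequency is rotated by `-λτ`, and
the coefficients are those of the harmonic oscillator of frequency `|λ|`. -/
noncomputable def backwardState (lam : ℝ) (ξ : CSpace d) (τ : ℝ) : CSpace d → ℂ :=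
  coherentState |lam|
    (Complex.I * d * (|lam| : ℝ) * τ
      + (‖ξ‖ ^ 2 / (2 * |lam|) : ℝ) * (Complex.exp (Complex.I * (|lam| : ℝ) * τ) ^ 2 - 1))
    (Complex.exp (Complex.I * (|lam| : ℝ) * τ)) (Complex.exp (-(Complex.I * lam * τ)) • ξ)

theorem hasDerivAt_backwardState {lam : ℝ} (hlam : lam ≠ 0) (ξ z : CSpace d) (t s : ℝ) :
    HasDerivAt (fun r => backwardState lam ξ (t - r) z)
      (-Complex.I * specialHermite lam (backwardState lam ξ (t - s)) z) s := by
  have hμ : ((|lam| : ℝ) : ℂ) ≠ 0 := by exact_mod_cast abs_ne_zero.2 hlam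
  rw [backwardState, specialHermite_coherentState _ _ _ _ (sq_abs lam), norm_smul]
  have hn : ‖Complex.exp (-(Complex.I * lam * ((t - s : ℝ) : ℂ)))‖ = 1 := by
    rw [Complex.norm_exp]; simp
  have hin : ∀ (τ : ℝ) (y : CSpace d), ⟪Complex.exp (-(Complex.I * lam * (τ : ℂ))) • ξ, y⟫_ℝ
      = Real.cos (lam * τ) * ⟪ξ, y⟫_ℝ + Real.sin (lam * τ) * ⟪ξ, Complex.I • y⟫_ℝ := by
    intro τ y
    have : -(Complex.I * lam * (τ : ℂ)) = ((-(lam * τ) : ℝ) : ℂ) * Complex.I := by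
      push_cast; ring
    rw [inner_complex_smul_left, this, Complex.exp_ofReal_mul_I_re, Complex.exp_ofReal_mul_I_im,
      Real.cos_neg, Real.sin_neg]
    ring
  have hτ : HasDerivAt (fun r : ℝ => ((t - r : ℝ) : ℂ)) (-1) s := by
    simpa using ((hasDerivAt_id s).const_sub t).ofReal_comp
  have hw : HasDerivAt (fun r : ℝ => Complex.exp (Complex.I * (|lam| : ℝ) * ((t - r : ℝ) : ℂ)))
      (Complex.exp (Complex.I * (|lam| : ℝ) * ((t - s : ℝ) : ℂ))
        * (Complex.I * (|lam| : ℝ) * (-1))) s :=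
    (hτ.const_mul _).cexp
  have hcos : HasDerivAt (fun r : ℝ => Real.cos (lam * (t - r)))
      (-Real.sin (lam * (t - s)) * (lam * (-1))) s :=
    (((hasDerivAt_id s).const_sub t).const_mul lam).cos
  have hsin : HasDerivAt (fun r : ℝ => Real.sin (lam * (t - r)))
      (Real.cos (lam * (t - s)) * (lam * (-1))) s :=
    (((hasDerivAt_id s).const_sub t).const_mul lam).sin
  have hq := (((((hτ.const_mul (Complex.I * d * (|lam| : ℝ))).add
    (((hw.pow 2).sub_const 1).const_mul ((‖ξ‖ ^ 2 / (2 * |lam|) : ℝ) : ℂ))).sub_const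
    ((|lam| / 4 * ‖z‖ ^ 2 : ℝ) : ℂ)).add ((hw.const_mul Complex.I).mul
    (((hcos.mul_const ⟪ξ, z⟫_ℝ).add (hsin.mul_const ⟪ξ, Complex.I • z⟫_ℝ)).ofReal_comp)))).cexp
  have hfun : (fun r => backwardState lam ξ (t - r) z) = fun r : ℝ => Complex.exp
      (Complex.I * d * (|lam| : ℝ) * ((t - r : ℝ) : ℂ)
        + (‖ξ‖ ^ 2 / (2 * |lam|) : ℝ) *
          (Complex.exp (Complex.I * (|lam| : ℝ) * ((t - r : ℝ) : ℂ)) ^ 2 - 1)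
        - ((|lam| / 4 * ‖z‖ ^ 2 : ℝ) : ℂ)
        + Complex.I * Complex.exp (Complex.I * (|lam| : ℝ) * ((t - r : ℝ) : ℂ)) *
          ((Real.cos (lam * (t - r)) * ⟪ξ, z⟫_ℝ
            + Real.sin (lam * (t - r)) * ⟪ξ, Complex.I • z⟫_ℝ : ℝ) : ℂ)) := by
    funext r
    rw [backwardState, coherentState, hin]
  rw [hfun]
  refine hq.congr_deriv ?_
  rw [coherentState, hn, one_mul, hin, hin, smul_smul, Complex.I_mul_I, neg_one_smul,
    inner_neg_right]
  simp only [Pi.add_apply, Pi.mul_apply, Pi.pow_apply]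
  push_cast
  rw [mul_left_comm (-Complex.I)]
  congr 1
  field_simp
  ring

/-- The Gaussian majorant is uniform in time, because the coefficients of the evolved state are
bounded. -/
theorem exists_gaussian_dominates_backwardState {lam : ℝ} (hlam : lam ≠ 0) (ξ : CSpace d) :
    ∃ K : ℝ, ∀ τ z, ‖backwardState lam ξ τ z‖ ≤ K * Real.exp (-(|lam| / 8) * ‖z‖ ^ 2) ∧
      ‖z‖ * ‖backwardState lam ξ τ z‖ ≤ K * Real.exp (-(|lam| / 8) * ‖z‖ ^ 2) ∧
      (∀ v, ‖fderiv ℝ (backwardState lam ξ τ) z v‖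
        ≤ ‖v‖ * (K * Real.exp (-(|lam| / 8) * ‖z‖ ^ 2))) ∧
      ‖specialHermite lam (backwardState lam ξ τ) z‖
        ≤ K * Real.exp (-(|lam| / 8) * ‖z‖ ^ 2) := by
  have hμ : 0 < |lam| := abs_pos.2 hlam
  set P : ℝ := 1 + |lam| / 2 + ‖ξ‖ + |lam| * d + 2 * |lam| * ‖ξ‖ + ‖ξ‖ ^ 2 with hP
  have hP0 : 0 ≤ P := by positivity
  refine ⟨P * Real.exp (‖ξ‖ ^ 2 / |lam| + 2 * (‖ξ‖ + 1) ^ 2 / |lam|), fun τ z => ?_⟩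
  set c : ℂ := Complex.I * d * (|lam| : ℝ) * τ
      + (‖ξ‖ ^ 2 / (2 * |lam|) : ℝ) * (Complex.exp (Complex.I * (|lam| : ℝ) * τ) ^ 2 - 1) with hc
  set w : ℂ := Complex.exp (Complex.I * (|lam| : ℝ) * τ) with hw
  set η : CSpace d := Complex.exp (-(Complex.I * lam * τ)) • ξ with hη
  have hφ : backwardState lam ξ τ = coherentState |lam| c w η := rfl
  have hw1 : ‖w‖ = 1 := by rw [hw, Complex.norm_exp]; simp
  have hη1 : ‖η‖ = ‖ξ‖ := by rw [hη, norm_smul, Complex.norm_exp]; simp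
  have hcA : c.re ≤ ‖ξ‖ ^ 2 / |lam| := by
    have h1 : c.re = ‖ξ‖ ^ 2 / (2 * |lam|) * (w ^ 2 - 1).re := by
      rw [hc, Complex.add_re, Complex.re_ofReal_mul]
      simp
    have h2 : (w ^ 2 - 1).re ≤ 2 := by
      refine (Complex.re_le_norm _).trans ((norm_sub_le _ _).trans ?_)
      rw [norm_pow, hw1]; norm_num
    calc c.re ≤ ‖ξ‖ ^ 2 / (2 * |lam|) * 2 := by rw [h1]; gcongr
      _ = _ := by field_simp
  have key := norm_coherentState_mul_le |lam| c w η hμ hcA hw1.le z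
  rw [hη1] at key
  have key' : ∀ a : ℝ, a ≤ P * (1 + ‖z‖) → a * ‖coherentState |lam| c w η z‖
      ≤ P * Real.exp (‖ξ‖ ^ 2 / |lam| + 2 * (‖ξ‖ + 1) ^ 2 / |lam|)
        * Real.exp (-(|lam| / 8) * ‖z‖ ^ 2) := by
    intro a ha
    calc _ ≤ P * (1 + ‖z‖) * ‖coherentState |lam| c w η z‖ := by gcongr
      _ = P * ((1 + ‖z‖) * ‖coherentState |lam| c w η z‖) := by ring
      _ ≤ P * (Real.exp (‖ξ‖ ^ 2 / |lam| + 2 * (‖ξ‖ + 1) ^ 2 / |lam|)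
        * Real.exp (-(|lam| / 8) * ‖z‖ ^ 2)) := by gcongr
      _ = _ := (mul_assoc _ _ _).symm
  have hz := norm_nonneg z
  have hξ := norm_nonneg ξ
  have hd : (0 : ℝ) ≤ d := Nat.cast_nonneg d
  have hlξ : 0 ≤ |lam| * ‖ξ‖ := by positivity
  have hld : 0 ≤ |lam| * d := by positivity
  have hξ2 := sq_nonneg ‖ξ‖
  have hPz : 0 ≤ P * ‖z‖ := by positivity
  have hin : ∀ v : CSpace d, ‖(⟪η, v⟫_ℝ : ℂ)‖ ≤ ‖ξ‖ * ‖v‖ := fun v => by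
    rw [Complex.norm_real, ← hη1]; exact norm_inner_le_norm _ _
  rw [hφ]
  refine ⟨?_, ?_, ?_, ?_⟩
  · simpa using key' 1 (by rw [mul_add, mul_one]; linarith)
  · refine key' ‖z‖ ?_
    have : ‖z‖ ≤ P * ‖z‖ := le_mul_of_one_le_left hz (by linarith)
    linarith
  · intro v
    rw [fderiv_coherentState, norm_mul, mul_comm]
    have h1 : ‖(-(((|lam| : ℝ) : ℂ) / 2) * (⟪z, v⟫_ℝ : ℂ) + Complex.I * w * (⟪η, v⟫_ℝ : ℂ))‖
        ≤ ‖v‖ * (|lam| / 2 * ‖z‖ + ‖ξ‖) := by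
      refine (norm_add_le _ _).trans ?_
      rw [norm_mul, norm_mul, norm_mul, Complex.norm_I, hw1, norm_neg, norm_div,
        Complex.norm_real, Complex.norm_real, Real.norm_eq_abs, abs_abs, Complex.norm_ofNat]
      have h2 : ‖⟪z, v⟫_ℝ‖ ≤ ‖z‖ * ‖v‖ := norm_inner_le_norm _ _
      have h3 := mul_le_mul_of_nonneg_left h2 (show 0 ≤ |lam| / 2 by positivity)
      linarith [hin v]
    have h4 : |lam| / 2 * ‖z‖ + ‖ξ‖ ≤ P * (1 + ‖z‖) := by
      have : |lam| / 2 * ‖z‖ ≤ P * ‖z‖ := by gcongr; linarith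
      linarith
    calc _ ≤ ‖v‖ * (|lam| / 2 * ‖z‖ + ‖ξ‖) * ‖coherentState |lam| c w η z‖ := by gcongr
      _ = ‖v‖ * ((|lam| / 2 * ‖z‖ + ‖ξ‖) * ‖coherentState |lam| c w η z‖) := by ring
      _ ≤ _ := mul_le_mul_of_nonneg_left (key' _ h4) (norm_nonneg _)
  · rw [specialHermite_coherentState _ _ _ _ (sq_abs lam), norm_mul, mul_comm]
    refine (mul_le_mul_of_nonneg_right ?_ (norm_nonneg _)).trans
      (key' (|lam| * d + |lam| * (‖ξ‖ * ‖z‖) + ‖ξ‖ ^ 2 + |lam| * (‖ξ‖ * ‖z‖)) ?_)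
    · refine (norm_add_le _ _).trans (add_le_add ((norm_add_le _ _).trans (add_le_add
        ((norm_add_le _ _).trans (add_le_add ?_ ?_)) ?_)) ?_)
      · simp
      · rw [norm_mul, norm_mul, norm_mul, Complex.norm_I, hw1, Complex.norm_real,
          Real.norm_eq_abs, abs_abs, one_mul, mul_one]
        gcongr; exact hin z
      · rw [norm_mul, norm_pow, hw1, hη1, Complex.norm_real]; simp
      · rw [norm_mul, norm_mul, hw1, Complex.norm_real, Real.norm_eq_abs, mul_one]
        gcongr
        refine (hin _).trans (le_of_eq ?_)
        rw [norm_smul, Complex.norm_I, one_mul]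
    · have : 2 * |lam| * ‖ξ‖ * ‖z‖ ≤ P * ‖z‖ := by gcongr; linarith
      linarith

/-- A weak solution is tested at time `t` against a coherent state by testing its initial value
against the evolved coherent state. -/
theorem integral_mul_conj_coherentState {lam : ℝ} (hlam : lam ≠ 0) {u₀ : L2CSpace d}
    {u : ℝ → L2CSpace d} (hu : IsSpecialHermiteSchrodingerSolution lam u₀ u) {t : ℝ} (ht : 0 < t)
    (ξ : CSpace d) :
    ∫ z, u t z * conj (coherentState |lam| 0 1 ξ z)
      = ∫ z, u₀ z * conj (backwardState lam ξ t z) := by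
  obtain ⟨K, hK⟩ := exists_gaussian_dominates_backwardState hlam ξ
  have h := integral_mul_conj_eq_of_classical_solution hu
    (φ := fun s => backwardState lam ξ (t - s))
    (memLp_two_exp_neg_mul_norm_sq (a := |lam| / 8) (by positivity) K)
    (fun s => contDiff_coherentState _ _ _ _) (fun s z => (hK (t - s) z).1)
    (fun s z => (hK (t - s) z).2.1) (fun s z => (hK (t - s) z).2.2.1)
    (fun s z => (hK (t - s) z).2.2.2) (fun s z => hasDerivAt_backwardState hlam ξ z t s) ht
  simpa [backwardState] using h

end Evolution

/-! ### The Schrödinger kernel -/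

section KernelRepresentation

variable {d : ℕ}

theorem conj_coherentState (μ : ℝ) (ξ z : CSpace d) :
    conj (coherentState μ 0 1 ξ z)
      = Complex.exp (-(μ / 4) * (‖z‖ : ℂ) ^ 2 - Complex.I * (⟪ξ, z⟫_ℝ : ℂ)) := by
  rw [coherentState, ← Complex.exp_conj]
  congr 1
  simp [map_ofNat]
  ring

theorem fourier_mul_gaussian (μ : ℝ) (h : CSpace d → ℂ) (ζ : CSpace d) :
    𝓕 (fun z => h z * Complex.exp (-(μ / 4) * (‖z‖ : ℂ) ^ 2)) ζ
      = ∫ z, h z * conj (coherentState μ 0 1 ((2 * Real.pi) • ζ) z) := by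
  rw [Real.fourier_eq']
  congr 1
  ext z
  rw [conj_coherentState, smul_eq_mul, mul_left_comm, ← Complex.exp_add, inner_smul_left,
    real_inner_comm ζ z]
  congr 2
  simp
  ring

theorem integrable_coherentState {μ : ℝ} (hμ : 0 < μ) (ξ : CSpace d) :
    Integrable (fun z => conj (coherentState μ 0 1 ξ z)) := by
  have h := GaussianFourier.integrable_cexp_neg_mul_sq_norm_add (V := CSpace d)
    (b := (μ / 4 : ℝ)) (by simpa using hμ) (-Complex.I) ξ
  refine h.congr (Filter.Eventually.of_forall fun z => ?_)
  simp only [conj_coherentState]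
  congr 1
  push_cast
  ring

/-- A function is determined almost everywhere by its pairings with the coherent states: these are
the values of the Fourier transform of its product with a Gaussian. -/
theorem ae_eq_of_integral_mul_conj_coherentState_eq {μ : ℝ} {h₁ h₂ : CSpace d → ℂ}
    (hi₁ : Integrable fun z => h₁ z * Complex.exp (-(μ / 4) * (‖z‖ : ℂ) ^ 2))
    (hi₂ : Integrable fun z => h₂ z * Complex.exp (-(μ / 4) * (‖z‖ : ℂ) ^ 2))
    (h : ∀ ξ : CSpace d, ∫ z, h₁ z * conj (coherentState μ 0 1 ξ z)
      = ∫ z, h₂ z * conj (coherentState μ 0 1 ξ z)) : h₁ =ᵐ[volume] h₂ := by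
  have hF : 𝓕 ((fun z => h₁ z * Complex.exp (-(μ / 4) * (‖z‖ : ℂ) ^ 2))
      - fun z => h₂ z * Complex.exp (-(μ / 4) * (‖z‖ : ℂ) ^ 2)) = 0 := by
    ext ζ
    rw [sub_eq_add_neg, ← neg_one_smul ℂ, Real.fourier_eq]
    have e1 := (Real.fourierIntegral_convergent_iff (μ := volume) ζ).2 hi₁
    have e2 := (Real.fourierIntegral_convergent_iff (μ := volume) ζ).2 hi₂
    have e3 := fourier_mul_gaussian μ h₁ ζ
    have e4 := fourier_mul_gaussian μ h₂ ζ
    rw [Real.fourier_eq] at e3 e4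
    rw [h, ← e4] at e3
    have e5 := integral_sub e1 e2
    rw [e3, sub_self] at e5
    rw [Pi.zero_apply, ← e5]
    congr 1; ext z
    simp [sub_eq_add_neg]
  have h0 := ae_eq_zero_of_fourier_ae_eq_zero (hi₁.sub hi₂) (by rw [hF])
  filter_upwards [h0] with z hz
  rw [Pi.sub_apply, ← sub_mul, Pi.zero_apply] at hz
  exact sub_eq_zero.1 ((mul_eq_zero.1 hz).resolve_right (Complex.exp_ne_zero _))

theorem integrable_mul_gaussian {μ : ℝ} (hμ : 0 < μ) (u : L2CSpace d) :
    Integrable fun z => u z * Complex.exp (-(μ / 4) * (‖z‖ : ℂ) ^ 2) := by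
  have h1 : MemLp (fun z : CSpace d => Complex.exp (-(μ / 4) * (‖z‖ : ℂ) ^ 2)) 2 volume := by
    refine memLp_of_norm_le_mul (K := 1) (Continuous.aestronglyMeasurable (by fun_prop))
      (memLp_two_exp_neg_mul_norm_sq (a := μ / 4) (by positivity) 1) fun z => ?_
    rw [Complex.norm_exp]
    simp [← Complex.ofReal_pow]
  exact (Lp.memLp u).integrable_mul h1

/-- Uniqueness of weak solutions. -/
theorem eq_zero_of_initial_eq_zero {lam : ℝ} (hlam : lam ≠ 0) {u : ℝ → L2CSpace d}
    (hu : IsSpecialHermiteSchrodingerSolution lam 0 u) {t : ℝ} (ht : 0 ≤ t) : u t = 0 := by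
  rcases ht.eq_or_lt with rfl | ht
  · exact hu.initial
  have hμ : 0 < |lam| := abs_pos.2 hlam
  rw [Lp.ext_iff]
  refine (ae_eq_of_integral_mul_conj_coherentState_eq (μ := |lam|) (h₂ := (0 : L2CSpace d))
    (integrable_mul_gaussian hμ _) (integrable_mul_gaussian hμ _) fun ξ => ?_)
  rw [integral_mul_conj_coherentState hlam hu ht ξ]
  have h0 : ∀ ψ : CSpace d → ℂ, ∫ z, (0 : L2CSpace d) z * conj (ψ z) = 0 := by
    intro ψ
    refine integral_eq_zero_of_ae ?_
    filter_upwards [Lp.coeFn_zero ℂ 2 (volume : Measure (CSpace d))] with z hz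
    rw [hz]; simp
  rw [h0, h0]

theorem inner_complex_smul_right (a : ℂ) (x z : CSpace d) :
    ⟪x, a • z⟫_ℝ = a.re * ⟪x, z⟫_ℝ + a.im * ⟪x, Complex.I • z⟫_ℝ := by
  simp only [PiLp.inner_apply, Finset.mul_sum, ← Finset.sum_add_distrib]
  refine Finset.sum_congr rfl fun j _ => ?_
  simp [Complex.inner]
  ring

theorem inner_complex_smul_comm (a : ℂ) (x z : CSpace d) : ⟪a • x, z⟫_ℝ = ⟪x, conj a • z⟫_ℝ := by
  rw [inner_complex_smul_left, inner_complex_smul_right (conj a)]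
  simp [sub_eq_add_neg]

/-- The quadratic coefficient `(λ/4) cot(λt)` of the phase of the Schrödinger kernel. -/
noncomputable def kernelChirp (lam t : ℝ) : ℝ :=
  |lam| / 4 * (Real.cos (|lam| * t) / Real.sin (|lam| * t))

/-- The complex number `m` for which `⟪m w, z⟫` is the mixed term of the phase of the Schrödinger
kernel. -/
noncomputable def kernelFrequency (lam t : ℝ) : ℂ :=
  -((|lam| / (2 * Real.sin (|lam| * t)) : ℝ) : ℂ) * Complex.exp (Complex.I * lam * t)

/-- The constant in front of the Schrödinger kernel, given through the Gaussian integral that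
normalises it. -/
noncomputable def kernelConstant (d : ℕ) (lam t : ℝ) : ℂ :=
  Complex.exp (-(Complex.I * d * (|lam| : ℝ) * t)) *
    ((Real.pi / ((|lam| / 4 : ℝ) - Complex.I * (kernelChirp lam t : ℝ)))
      ^ ((Module.finrank ℝ (CSpace d) : ℂ) / 2))⁻¹

/-- The kernel of the propagator of the special Hermite Schrödinger equation at a time `t` with
`λt ∉ πℤ`. -/
noncomputable def schrodingerKernel (lam t : ℝ) (z w : CSpace d) : ℂ :=
  kernelConstant d lam t * Complex.exp (Complex.I *
    ((kernelChirp lam t * ‖z‖ ^ 2 + kernelChirp lam t * ‖w‖ ^ 2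
      + ⟪kernelFrequency lam t • w, z⟫_ℝ : ℝ) : ℂ))

/-- The kernel, integrated against a coherent state, gives the evolved coherent state: a Gaussian
integral. -/
theorem integral_schrodingerKernel_mul_conj_coherentState {lam : ℝ} (hlam : lam ≠ 0) {t : ℝ}
    (hs : Real.sin (|lam| * t) ≠ 0) (ξ w : CSpace d) :
    ∫ z, schrodingerKernel lam t z w * conj (coherentState |lam| 0 1 ξ z)
      = conj (backwardState lam ξ t w) := by
  have hμ : 0 < |lam| := abs_pos.2 hlam
  set b : ℂ := ((|lam| / 4 : ℝ) : ℂ) - Complex.I * (kernelChirp lam t : ℝ) with hb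
  have hbre : 0 < b.re := by
    simp only [hb, Complex.sub_re, Complex.ofReal_re, Complex.mul_re, Complex.I_re, Complex.I_im,
      Complex.ofReal_im]
    linarith
  have hb0 : b ≠ 0 := fun h => by rw [h] at hbre; simp at hbre
  have hG := GaussianFourier.integral_cexp_neg_mul_sq_norm_add hbre Complex.I
    (kernelFrequency lam t • w - ξ)
  have h1 : ∀ z : CSpace d, schrodingerKernel lam t z w * conj (coherentState |lam| 0 1 ξ z)
      = (kernelConstant d lam t * Complex.exp (Complex.I * (kernelChirp lam t * ‖w‖ ^ 2 : ℝ)))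
        * Complex.exp (-b * (‖z‖ : ℂ) ^ 2
          + Complex.I * (⟪kernelFrequency lam t • w - ξ, z⟫_ℝ : ℂ)) := by
    intro z
    rw [schrodingerKernel, conj_coherentState, mul_assoc, mul_assoc, ← Complex.exp_add,
      ← Complex.exp_add, inner_sub_left, hb]
    congr 2
    push_cast
    ring
  simp only [h1]
  rw [integral_const_mul, hG, kernelConstant, ← hb]
  have hP : ((Real.pi / b : ℂ) ^ ((Module.finrank ℝ (CSpace d) : ℂ) / 2)) ≠ 0 := by
    rw [Complex.cpow_ne_zero_iff]
    left
    exact div_ne_zero (by exact_mod_cast Real.pi_ne_zero) hb0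
  have h2 : ∀ a p e f : ℂ, p ≠ 0 → a * p⁻¹ * e * (p * f) = a * (e * f) := by
    intro a p e f hp
    field_simp
  rw [h2 _ _ _ _ hP, ← Complex.exp_add, ← Complex.exp_add, backwardState, coherentState,
    ← Complex.exp_conj]
  congr 1
  set X : ℝ := ⟪Complex.exp (-(Complex.I * lam * t)) • ξ, w⟫_ℝ with hX
  set S : ℝ := Real.sin (|lam| * t) with hS
  set Co : ℝ := Real.cos (|lam| * t) with hCo
  have hSC : S ^ 2 + Co ^ 2 = 1 := Real.sin_sq_add_cos_sq _
  have hinner : ⟪kernelFrequency lam t • w, ξ⟫_ℝ = -(|lam| / (2 * S)) * X := by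
    have : kernelFrequency lam t • w
        = (-(|lam| / (2 * S)) : ℝ) • (Complex.exp (Complex.I * lam * t) • w) := by
      rw [kernelFrequency, mul_smul, ← Complex.ofReal_neg, Complex.coe_smul]
    rw [this, inner_smul_left, real_inner_comm, hX, inner_complex_smul_comm, ← Complex.exp_conj]
    simp
  have hnorm : ‖kernelFrequency lam t • w - ξ‖ ^ 2
      = (|lam| / (2 * S)) ^ 2 * ‖w‖ ^ 2 + |lam| / S * X + ‖ξ‖ ^ 2 := by
    have hn : ‖kernelFrequency lam t‖ ^ 2 = (|lam| / (2 * S)) ^ 2 := by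
      rw [kernelFrequency, norm_mul, norm_neg, Complex.norm_real, Complex.norm_exp]
      simp [hS, div_pow, mul_pow]
    rw [norm_sub_sq_real, hinner, norm_smul, mul_pow, hn]
    field_simp
    ring
  have hexp : Complex.exp (Complex.I * (|lam| : ℝ) * t) = Co + S * Complex.I := by
    have : Complex.I * (|lam| : ℝ) * (t : ℂ) = ((|lam| * t : ℝ) : ℂ) * Complex.I := by
      push_cast; ring
    rw [this, Complex.exp_mul_I, ← Complex.ofReal_cos, ← Complex.ofReal_sin]
  rw [hexp]
  have hnorm' : (‖kernelFrequency lam t • w - ξ‖ : ℂ) ^ 2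
      = ((|lam| / (2 * S)) ^ 2 * ‖w‖ ^ 2 + |lam| / S * X + ‖ξ‖ ^ 2 : ℝ) := by
    rw [← hnorm]; push_cast; rfl
  have hSC' : (S : ℂ) ^ 2 + (Co : ℂ) ^ 2 = 1 := by exact_mod_cast hSC
  have hS' : (S : ℂ) ≠ 0 := by exact_mod_cast hs
  have hμ' : ((|lam| : ℝ) : ℂ) ≠ 0 := by exact_mod_cast hμ.ne'
  -- `1 / (4b) = S (S + i Co) / |λ|`
  have hbinv : (4 * b)⁻¹ = S * (S + Complex.I * Co) / (|lam| : ℝ) := by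
    refine inv_eq_of_mul_eq_one_right ?_
    rw [hb, kernelChirp, ← hS, ← hCo]
    push_cast
    field_simp
    linear_combination hSC' - (Co : ℂ) ^ 2 * Complex.I_sq
  rw [hnorm', Complex.I_sq, div_eq_mul_inv, hbinv, kernelChirp, ← hS, ← hCo]
  simp only [map_add, map_sub, map_mul, map_pow, map_one, Complex.conj_I, Complex.conj_ofReal,
    Complex.conj_natCast]
  push_cast
  field_simp
  ring_nf
  simp only [Complex.I_sq]
  linear_combination (-8 * (S : ℂ) * (‖ξ‖ : ℂ) ^ 2) * hSC'

theorem continuous_schrodingerKernel (lam t : ℝ) :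
    Continuous fun p : CSpace d × CSpace d => schrodingerKernel lam t p.1 p.2 := by
  have h : Continuous fun p : CSpace d × CSpace d => ⟪kernelFrequency lam t • p.2, p.1⟫_ℝ :=
    Continuous.inner (𝕜 := ℝ) (continuous_snd.const_smul (kernelFrequency lam t)) continuous_fst
  have h1 : Continuous fun p : CSpace d × CSpace d =>
      kernelChirp lam t * ‖p.1‖ ^ 2 + kernelChirp lam t * ‖p.2‖ ^ 2
        + ⟪kernelFrequency lam t • p.2, p.1⟫_ℝ :=
    ((continuous_const.mul (continuous_fst.norm.pow 2)).add
      (continuous_const.mul (continuous_snd.norm.pow 2))).add h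
  exact continuous_const.mul (continuous_const.mul (Complex.continuous_ofReal.comp h1)).cexp

theorem norm_schrodingerKernel (lam t : ℝ) (z w : CSpace d) :
    ‖schrodingerKernel lam t z w‖ = ‖kernelConstant d lam t‖ := by
  rw [schrodingerKernel, norm_mul, Complex.norm_exp_I_mul_ofReal, mul_one]

theorem kernelConstant_ne_zero {lam : ℝ} (hlam : lam ≠ 0) (t : ℝ) :
    kernelConstant d lam t ≠ 0 := by
  refine mul_ne_zero (Complex.exp_ne_zero _) (inv_ne_zero ?_)
  rw [Complex.cpow_ne_zero_iff]
  refine Or.inl (div_ne_zero (by exact_mod_cast Real.pi_ne_zero) fun h => hlam ?_)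
  have := congrArg Complex.re h
  simpa using this

/-- Off the resonant times, a weak solution with integrable initial value is given by the kernel. -/
theorem ae_eq_integral_schrodingerKernel {lam : ℝ} (hlam : lam ≠ 0) {u₀ : L2CSpace d}
    {u : ℝ → L2CSpace d} (hu : IsSpecialHermiteSchrodingerSolution lam u₀ u) {t : ℝ} (ht : 0 < t)
    (hs : Real.sin (|lam| * t) ≠ 0) (hi : Integrable u₀) :
    u t =ᵐ[volume] fun z => ∫ w, schrodingerKernel lam t z w * u₀ w := by
  have hμ : 0 < |lam| := abs_pos.2 hlam
  have hint : ∀ ξ : CSpace d, Integrable (fun p : CSpace d × CSpace d =>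
      schrodingerKernel lam t p.1 p.2 * u₀ p.2 * conj (coherentState |lam| 0 1 ξ p.1))
      (volume.prod volume) := by
    intro ξ
    have h1 := (integrable_coherentState hμ ξ).mul_prod hi
    have h2 := h1.bdd_mul (c := ‖kernelConstant d lam t‖)
      (continuous_schrodingerKernel (d := d) lam t).aestronglyMeasurable
      (Filter.Eventually.of_forall fun p => (norm_schrodingerKernel lam t p.1 p.2).le)
    refine h2.congr (Filter.Eventually.of_forall fun p => ?_)
    simp only
    ring
  refine ae_eq_of_integral_mul_conj_coherentState_eq (integrable_mul_gaussian hμ _) ?_ fun ξ => ?_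
  · refine (hint 0).integral_prod_left.congr (Filter.Eventually.of_forall fun z => ?_)
    simp only [integral_mul_const, conj_coherentState, inner_zero_left]
    simp
  · rw [integral_mul_conj_coherentState hlam hu ht ξ]
    calc ∫ w, u₀ w * conj (backwardState lam ξ t w)
        = ∫ w, ∫ z, schrodingerKernel lam t z w * u₀ w * conj (coherentState |lam| 0 1 ξ z) := by
          congr 1; ext w
          rw [← integral_schrodingerKernel_mul_conj_coherentState hlam hs ξ w,
            ← integral_const_mul]
          congr 1; ext z; ring
      _ = ∫ z, ∫ w, schrodingerKernel lam t z w * u₀ w * conj (coherentState |lam| 0 1 ξ z) :=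
          (integral_integral_swap (hint ξ)).symm
      _ = _ := by simp only [integral_mul_const]

/-- Up to unimodular factors, a constant and a complex dilation, the kernel acts on `g` as the
Fourier transform of `g` multiplied by a chirp. -/
theorem integral_schrodingerKernel_mul (lam t : ℝ) (g : CSpace d → ℂ) (z : CSpace d) :
    ∫ w, schrodingerKernel lam t z w * g w
      = kernelConstant d lam t * Complex.exp (Complex.I * (kernelChirp lam t * ‖z‖ ^ 2 : ℝ))
        * 𝓕 (fun w => Complex.exp (Complex.I * (kernelChirp lam t * ‖w‖ ^ 2 : ℝ)) * g w)
          ((-((2 * Real.pi : ℝ) : ℂ)⁻¹ * conj (kernelFrequency lam t)) • z) := by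
  rw [Real.fourier_eq', ← integral_const_mul]
  congr 1
  ext w
  have h1 : ⟪w, (-((2 * Real.pi : ℝ) : ℂ)⁻¹ * conj (kernelFrequency lam t)) • z⟫_ℝ
      = -(2 * Real.pi)⁻¹ * ⟪kernelFrequency lam t • w, z⟫_ℝ := by
    rw [inner_complex_smul_comm, mul_smul, ← Complex.ofReal_inv, ← Complex.ofReal_neg,
      Complex.coe_smul, inner_smul_right]
  have h2 : -2 * Real.pi * (-(2 * Real.pi)⁻¹ * ⟪kernelFrequency lam t • w, z⟫_ℝ)
      = ⟪kernelFrequency lam t • w, z⟫_ℝ := by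
    field_simp
  rw [h1, h2, schrodingerKernel, smul_eq_mul]
  have h3 : Complex.exp (Complex.I *
      ((kernelChirp lam t * ‖z‖ ^ 2 + kernelChirp lam t * ‖w‖ ^ 2
        + ⟪kernelFrequency lam t • w, z⟫_ℝ : ℝ) : ℂ))
      = Complex.exp (Complex.I * (kernelChirp lam t * ‖z‖ ^ 2 : ℝ))
        * Complex.exp (Complex.I * (kernelChirp lam t * ‖w‖ ^ 2 : ℝ))
        * Complex.exp ((⟪kernelFrequency lam t • w, z⟫_ℝ : ℂ) * Complex.I) := by
    rw [← Complex.exp_add, ← Complex.exp_add]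
    congr 1
    push_cast
    ring
  rw [h3]
  ring

end KernelRepresentation

/-! ### Supports of finite measure at two times -/

theorem corollary1p3 (d : ℕ) (hd : 1 ≤ d) (lam : ℝ) (hlam : lam ≠ 0)
    (E Ω : Set (CSpace d)) (hE : MeasurableSet E) (hΩ : MeasurableSet Ω)
    (hE_fin : volume E < ⊤) (hΩ_fin : volume Ω < ⊤)
    (u₀ : L2CSpace d) (u : ℝ → L2CSpace d)
    (hu : IsSpecialHermiteSchrodingerSolution lam u₀ u)
    (h : ∃ t : ℝ, 0 < t ∧ (∀ k : ℤ, lam * t ≠ k * Real.pi) ∧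
      (∀ᵐ z ∂volume, z ∉ E → u₀ z = 0) ∧ (∀ᵐ z ∂volume, z ∉ Ω → u t z = 0)) :
    ∀ s : ℝ, 0 ≤ s → u s = 0 := by
  obtain ⟨t, ht, hres, hE0, hΩ0⟩ := h
  suffices h0 : u₀ = 0 by
    subst h0
    exact fun s hs => eq_zero_of_initial_eq_zero hlam hu hs
  have hsin : Real.sin (|lam| * t) ≠ 0 := by
    intro h
    rw [Real.sin_eq_zero_iff] at h
    obtain ⟨k, hk⟩ := h
    rcases abs_choice lam with h' | h' <;> rw [h'] at hk
    · exact hres k hk.symm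
    · refine hres (-k) ?_
      push_cast
      linarith
  have hi : Integrable u₀ := by
    rw [← memLp_one_iff_integrable]
    refine ⟨Lp.aestronglyMeasurable u₀, ?_⟩
    rw [eLpNorm_eq_restrict_of_ae_eq_zero_off hE hE0]
    have : IsFiniteMeasure (volume.restrict E) := ⟨by simpa using hE_fin⟩
    exact (((Lp.memLp u₀).restrict E).mono_exponent (by norm_num)).2
  have hne : Nontrivial (CSpace d) := by
    have : Nonempty (Fin d) := ⟨⟨0, hd⟩⟩
    infer_instance
  have hrep := ae_eq_integral_schrodingerKernel hlam hu ht hsin hi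
  simp only [integral_schrodingerKernel_mul] at hrep
  set f : CSpace d → ℂ :=
    fun w => Complex.exp (Complex.I * (kernelChirp lam t * ‖w‖ ^ 2 : ℝ)) * u₀ w with hf
  set a : ℂ := -((2 * Real.pi : ℝ) : ℂ)⁻¹ * conj (kernelFrequency lam t) with ha
  have ha0 : a ≠ 0 := by
    refine mul_ne_zero (neg_ne_zero.2 (inv_ne_zero ?_)) ?_
    · exact_mod_cast Real.two_pi_pos.ne'
    · rw [Ne, map_eq_zero, kernelFrequency]
      refine mul_ne_zero (neg_ne_zero.2 ?_) (Complex.exp_ne_zero _)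
      exact_mod_cast div_ne_zero (abs_ne_zero.2 hlam) (mul_ne_zero two_ne_zero hsin)
  have hfi : Integrable f := by
    refine hi.bdd_mul (c := 1) (Continuous.aestronglyMeasurable (by fun_prop))
      (Filter.Eventually.of_forall fun w => ?_)
    rw [Complex.norm_exp_I_mul_ofReal]
  -- Undo the dilation by `a`: `𝓕 f` lives on `a • Ω`.
  let e : CSpace d ≃ₗ[ℝ] CSpace d :=
    (LinearEquiv.smulOfNeZero ℂ (CSpace d) a⁻¹ (inv_ne_zero ha0)).restrictScalars ℝ
  have hedet : LinearMap.det (e : CSpace d →ₗ[ℝ] CSpace d) ≠ 0 :=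
    (LinearEquiv.isUnit_det' e).ne_zero
  have hFz : ∀ᵐ z, z ∉ Ω → 𝓕 f (a • z) = 0 := by
    filter_upwards [hrep, hΩ0] with z h1 h2 h3
    rw [h2 h3] at h1
    exact (mul_eq_zero.1 h1.symm).resolve_left
      (mul_ne_zero (kernelConstant_ne_zero hlam t) (Complex.exp_ne_zero _))
  have hF : ∀ᵐ ζ, ζ ∉ (e : CSpace d →ₗ[ℝ] CSpace d) ⁻¹' Ω → 𝓕 f ζ = 0 := by
    filter_upwards [(Measure.LinearMap.quasiMeasurePreserving volume _ hedet).ae hFz] with ζ h1 h2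
    have := h1 h2
    have h3 : a • (e ζ) = ζ := by
      change a • (a⁻¹ • ζ) = ζ
      rw [smul_inv_smul₀ ha0]
    simpa [h3] using this
  have hfE : ∀ᵐ w, w ∉ E → f w = 0 := by
    filter_upwards [hE0] with w hw hwE
    rw [hf]
    simp [hw hwE]
  have hf0 := ae_eq_zero_of_fourier_ae_eq_zero_off hfi hE
    (hΩ.preimage
      (LinearMap.continuous_of_finiteDimensional (e : CSpace d →ₗ[ℝ] CSpace d)).measurable)
    hE_fin.ne
    (by
      rw [Measure.addHaar_preimage_linearMap _ hedet]
      exact ENNReal.mul_ne_top ENNReal.ofReal_ne_top hΩ_fin.ne) hfE hF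
  rw [Lp.eq_zero_iff_ae_eq_zero]
  filter_upwards [hf0] with w hw
  exact (mul_eq_zero.1 hw).resolve_left (Complex.exp_ne_zero _)
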